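/- **Lemma 3.3 (Runtime of NullGenFinding).** Let $(\mathbf A,\mathbf b,\mathbf c,\{r_i\}_{i=1}^m)$ be the data of the group relaxation $\min\{\mathbf c^\top \mathbf x : \mathbf x\in\mathbb Z_{\ge 0}^d,\ \mathbf A\mathbf x=\mathbf b \pmod{R\mathbb Z^m}\}$ of an integer linear program, where $m\ge 1$, $\mathbf A\in\mathbb Z^{m\times d}$, $\mathbf b\in\mathbb Z^m$, $\mathbf c\in\mathbb R_{\ge 0}^d$, and $R=\mathrm{diag}(r_1,\dots,r_m)$ with positive integers $r_1\mid r_2\mid\cdots\mid r_m$. Let $Z=\mathbb Z_{r_m}^d$, let $K=\{\mathbf x\in Z:\mathbf A\mathbf x=\mathbf 0 \pmod{R\mathbb Z^m}\}$ be the kernel of $\mathbf A$ as a homomorphism $Z\to\mathbb Z^m/R\mathbb Z^m\cong\bigoplus_{i=1}^m\mathbb Z_{r_i}$, and let $\|\mathbf A\|_\infty=\max_{i,j}|\mathbf A_{ij}|$. There is a classical deterministic algorithm (one fixed program of a random access machine on integers, every elementary step being charged according to the bit lengths of its operands and addresses) that, given $\mathbf A$ and $\{r_i\}_{i=1}^m$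 in memory, outputs vectors $h_1,\dots,h_k\in Z$ with $k=d$ (some of them possibly $0$), each given by its representative in $\{0,\dots,r_m-1\}^d$, that form an independent generating set of $K$: they generate $K$, and the sum of the cyclic subgroups $\langle h_1\rangle,\dots,\langle h_k\rangle$ is direct. Its running time is bounded by a fixed polynomial in $\log\|\mathbf A\|_\infty$, $d$, $m$ and $\log r_m$ (with $\log\|\mathbf A\|_\infty$ read as $0$ if $\mathbf A$ is zero or has no entries). In particular, $$K\cong\mathbb Z_{|\langle h_1\rangle|}\oplus\cdots\oplus\mathbb Z_{|\langle h_k\rangle|}.$$ -/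

import Mathlib

open scoped DirectSum

/-! ### Classical algorithms: random access machine programs with logarithmic cost -/

namespace RAM

/-- The memory consists of arrays of integers. `M a i` is the content of cell `i`
of array `a`. A program names its arrays explicitly, so that it uses a fixed finite number of
them; the cell index is computed at run time (indirect addressing). -/
abbrev Memory : Type := ℕ → ℤ → ℤ

/-- The binary length of an integer, without its sign. -/
def len (z : ℤ) : ℕ := z.natAbs.size

/-- The elementary arithmetic operations. -/
inductive Op : Type
  | add
  | sub
  | mul
  | div
  | mod

/-- Value of an elementary operation; `div` and `mod` are quotient and remainder of integer
division (the quotient by `0` is `0`, the remainder of `x` by `0` is `x`). -/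
def Op.eval : Op → ℤ → ℤ → ℤ
  | .add, x, y => x + y
  | .sub, x, y => x - y
  | .mul, x, y => x * y
  | .div, x, y => x / y
  | .mod, x, y => x % y

/-- Arithmetic expressions over the memory. -/
inductive Expr : Type
  | const (z : ℤ)
  | cell (a : ℕ) (i : Expr)
  | op (o : Op) (e₁ e₂ : Expr)

/-- Value of an expression. -/
def Expr.eval (M : Memory) : Expr → ℤ
  | .const z => z
  | .cell a i => M a (i.eval M)
  | .op o e₁ e₂ => o.eval (e₁.eval M) (e₂.eval M)

/-- Bit cost of evaluating an expression: reading a cell costs the length of its address and of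
its content, and an arithmetic operation costs the product of the lengths of its operands (each
increased by one), as in the schoolbook algorithms. -/
def Expr.cost (M : Memory) : Expr → ℕ
  | .const z => 1 + len z
  | .cell a i => i.cost M + 1 + len (i.eval M) + len (M a (i.eval M))
  | .op _ e₁ e₂ => e₁.cost M + e₂.cost M + (1 + len (e₁.eval M)) * (1 + len (e₂.eval M))

/-- Programs. The tests of `cond` and `loop` ask whether the value of an expression is positive. -/
inductive Prog : Type
  | skip
  | assign (a : ℕ) (i e : Expr)
  | seq (p q : Prog)
  | cond (e : Expr) (p q : Prog)
  | loop (e : Expr) (p : Prog)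

/-- Writing the value `z` into cell `i` of array `a`. -/
def Memory.write (M : Memory) (a : ℕ) (i z : ℤ) : Memory :=
  fun b j => if b = a ∧ j = i then z else M b j

/-- `Exec p M M' t`: program `p`, started with memory `M`, halts with memory `M'`, and the total
bit cost of the run is `t`. -/
inductive Exec : Prog → Memory → Memory → ℕ → Prop
  | skip (M : Memory) : Exec .skip M M 1
  | assign (a : ℕ) (i e : Expr) (M : Memory) :
      Exec (.assign a i e) M (M.write a (i.eval M) (e.eval M))
        (i.cost M + e.cost M + 1 + len (i.eval M) + len (e.eval M))
  | seq {p q : Prog} {M M' M'' : Memory} {t t' : ℕ} :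
      Exec p M M' t → Exec q M' M'' t' → Exec (.seq p q) M M'' (t + t')
  | cond_pos {e : Expr} {p q : Prog} {M M' : Memory} {t : ℕ} :
      0 < e.eval M → Exec p M M' t → Exec (.cond e p q) M M' (e.cost M + 1 + t)
  | cond_nonpos {e : Expr} {p q : Prog} {M M' : Memory} {t : ℕ} :
      e.eval M ≤ 0 → Exec q M M' t → Exec (.cond e p q) M M' (e.cost M + 1 + t)
  | loop_done {e : Expr} {p : Prog} {M : Memory} :
      e.eval M ≤ 0 → Exec (.loop e p) M M (e.cost M + 1)
  | loop_step {e : Expr} {p : Prog} {M M' M'' : Memory} {t t' : ℕ} :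
      0 < e.eval M → Exec p M M' t → Exec (.loop e p) M' M'' t' →
      Exec (.loop e p) M M'' (e.cost M + 1 + t + t')

end RAM

/-! ### Group relaxations and their kernel -/

/-- The data `(A, b, c, r₁ ∣ ⋯ ∣ r_m)` of the group relaxation
`min {cᵀ x : x ∈ ℤ_{≥ 0}^d, A x = b (mod R ℤ^m)}`, `R = diag(r₁, …, r_m)`, of an integer linear
program with `m ≥ 1` constraints. -/
structure GroupRelaxation where
  m : ℕ
  d : ℕ
  m_pos : 0 < m
  A : Matrix (Fin m) (Fin d) ℤ
  b : Fin m → ℤ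
  c : Fin d → ℝ
  r : Fin m → ℕ
  c_nonneg : ∀ j, 0 ≤ c j
  r_pos : ∀ i, 0 < r i
  r_dvd : ∀ i j, i ≤ j → r i ∣ r j

namespace GroupRelaxation

variable (G : GroupRelaxation)

/-- The index of the last constraint. -/
def lastRow : Fin G.m := ⟨G.m - 1, Nat.sub_lt G.m_pos Nat.one_pos⟩

/-- The largest invariant factor `r_m`. -/
def rLast : ℕ := G.r G.lastRow

theorem r_dvd_rLast (i : Fin G.m) : G.r i ∣ G.rLast :=
  G.r_dvd i G.lastRow (Nat.le_sub_one_of_lt i.isLt)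

/-- The group `Z = (ℤ / r_m)^d`. -/
abbrev Z : Type := Fin G.d → ZMod G.rLast

/-- The matrix `A` as a homomorphism from `Z` to `⨁ i, ℤ / r_i = ℤ^m / R ℤ^m`. It is well defined
since every `r_i` divides `r_m`. -/
def hom : G.Z →+ ((i : Fin G.m) → ZMod (G.r i)) where
  toFun x i := ∑ j, (G.A i j : ZMod (G.r i)) * ZMod.castHom (G.r_dvd_rLast i) (ZMod (G.r i)) (x j)
  map_zero' := by ext i; simp
  map_add' x y := by ext i; simp only [Pi.add_apply, map_add, mul_add, Finset.sum_add_distrib]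

/-- The kernel `K = {x ∈ Z : A x = 0 (mod R ℤ^m)}`. -/
def K : AddSubgroup G.Z := G.hom.ker

/-- The largest absolute value of an entry of `A` (`0` if there is no entry). -/
def normA : ℕ := Finset.univ.sup fun ij : Fin G.m × Fin G.d => (G.A ij.1 ij.2).natAbs

/-- The constraint data in memory: `m` and `d` in cells `0` and `1` of array `0`, the entries of
`A` row by row in array `1`, the `r_i` in array `2`; every other cell holds `0`. -/
def input : RAM.Memory := fun a z =>
  if a = 0 then (if z = 0 then (G.m : ℤ) else if z = 1 then (G.d : ℤ) else 0)
  else if a = 1 then ∑ i : Fin G.m, ∑ j : Fin G.d,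
    if z = (i : ℤ) * G.d + j then G.A i j else 0
  else if a = 2 then ∑ i : Fin G.m, if z = (i : ℤ) then (G.r i : ℤ) else 0
  else 0

/-- The memory `M` holds, row by row in array `3`, the vectors `h_1, …, h_d` of `Z`, every
coordinate being given by its representative in `{0, …, r_m - 1}`. -/
def IsOutput (M : RAM.Memory) (h : Fin G.d → G.Z) : Prop :=
  ∀ i j : Fin G.d, M 3 ((i : ℤ) * G.d + j) = ((h i j).val : ℤ)

end GroupRelaxation

/-!
# Independent generators of the kernel of a group relaxation in polynomial time

Put `N = r_m`. Multiplying row `i` of `A` by `N / r_i` turns all congruences into congruences modulo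
`N`, so `K` is the kernel of a matrix `B` over `ℤ / N` (`GroupRelaxation.mem_K_iff`). If
`U B V = D` is diagonal with `U`, `V` invertible, then `K = V (ker D)`, and `ker D` is the direct
sum of the groups generated by `(N / gcd(D_ll, N)) e_l`. Hence the columns of `V`, multiplied by
these factors, are independent generators of `K` (`closure_generator`, `generator_independent`).
Zero rows are added to `B` so that every column has a diagonal entry; a zero entry there has
factor `1`, so that exactly `d` generators come out, some of them possibly zero.

The algorithm keeps `B` and, below it, `V` in one matrix with entries in `{0, …, N - 1}`, and uses
only operations on two rows of `B` or on two columns of the whole matrix, with determinant `± 1`.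
They preserve the invariant `Inv`. In phase `t`, any nonzero entry `y` below or to the right of the
pivot `a` at `(t, t)` is divided by `a`, with the remainder of least absolute value. If the
remainder is zero, `y` is eliminated; otherwise the remainder becomes the new pivot and is at most
`a / 2`. A pivot `0` is read as `N`, which makes it no exception. Thus
`(n + d + 1) * size a`, plus the number of nonzero entries left in the row and the column of the
pivot, decreases in every step (`potential_rowOp`, `potential_colOp`), and a phase takes
polynomially many steps. No growth of entries has to be controlled, everything being reduced
modulo `N`.

Running times are handled by a Hoare logic: `Runs β p M n Q` says that `p` halts within `n` elementary
statements, at a total cost of at most `n * unit β`, with contents of the final memory of absolute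
value at most `β`; every rule keeps this bound on the memory. Since `size β` is polynomial in the parameters, so is the total bit cost
(`GroupRelaxation.steps_mul_unit_le`).
-/

/-! ### Expressions and memory -/

namespace RAM

instance : Add Expr := ⟨.op .add⟩
instance : Sub Expr := ⟨.op .sub⟩
instance : Mul Expr := ⟨.op .mul⟩
instance : Div Expr := ⟨.op .div⟩
instance : Mod Expr := ⟨.op .mod⟩
instance (n : ℕ) : OfNat Expr n := ⟨.const n⟩

/-- The scalar variable kept in cell `0` of array `a`. -/
abbrev var (a : ℕ) : Expr := .cell a 0

section eval
variable (M : Memory) (e₁ e₂ : Expr)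
@[simp] theorem eval_add : (e₁ + e₂).eval M = e₁.eval M + e₂.eval M := rfl
@[simp] theorem eval_sub : (e₁ - e₂).eval M = e₁.eval M - e₂.eval M := rfl
@[simp] theorem eval_mul : (e₁ * e₂).eval M = e₁.eval M * e₂.eval M := rfl
@[simp] theorem eval_div : (e₁ / e₂).eval M = e₁.eval M / e₂.eval M := rfl
@[simp] theorem eval_mod : (e₁ % e₂).eval M = e₁.eval M % e₂.eval M := rfl
@[simp] theorem eval_cell (a : ℕ) : (Expr.cell a e₁).eval M = M a (e₁.eval M) := rfl
@[simp] theorem eval_zero : (0 : Expr).eval M = 0 := rfl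
@[simp] theorem eval_one : (1 : Expr).eval M = 1 := rfl
@[simp] theorem eval_two : (2 : Expr).eval M = 2 := rfl
end eval

theorem write_apply (M : Memory) (a : ℕ) (i z : ℤ) (b : ℕ) (j : ℤ) :
    M.write a i z b j = if b = a ∧ j = i then z else M b j := rfl

@[simp] theorem write_same (M : Memory) (a : ℕ) (i z : ℤ) : M.write a i z a i = z := by
  simp [write_apply]

theorem write_of_ne (M : Memory) {a b : ℕ} (i z : ℤ) (h : b ≠ a) : M.write a i z b = M b := by
  funext j; simp [write_apply, h]

/-! ### Cost of expressions -/

/-- A size of an expression which does not depend on the memory: the number of its nodes, where a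
constant counts by its absolute value. -/
def Expr.wt : Expr → ℕ
  | .const z => 1 + z.natAbs
  | .cell _ i => i.wt + 1
  | .op _ e₁ e₂ => e₁.wt + e₂.wt + 1

theorem size_add_le (x y : ℕ) : (x + y).size ≤ x.size + y.size + 1 := by
  rw [Nat.size_le]
  have hx := Nat.lt_size_self x
  have hy := Nat.lt_size_self y
  have h₁ : 2 ^ x.size ≤ 2 ^ (x.size + y.size) := Nat.pow_le_pow_right (by norm_num) (by omega)
  have h₂ : 2 ^ y.size ≤ 2 ^ (x.size + y.size) := Nat.pow_le_pow_right (by norm_num) (by omega)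
  rw [pow_succ]
  omega

theorem size_mul_le (x y : ℕ) : (x * y).size ≤ x.size + y.size := by
  rw [Nat.size_le, pow_add]
  exact Nat.mul_lt_mul'' (Nat.lt_size_self x) (Nat.lt_size_self y)

theorem size_le_self (n : ℕ) : n.size ≤ n := Nat.size_le.2 Nat.lt_two_pow_self

theorem len_op_le (o : Op) (x y : ℤ) : len (o.eval x y) ≤ len x + len y + 1 := by
  unfold len
  cases o with
  | add => exact (Nat.size_le_size (Int.natAbs_add_le x y)).trans (size_add_le _ _)
  | sub => exact (Nat.size_le_size (Int.natAbs_sub_le x y)).trans (size_add_le _ _)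
  | mul =>
    have := size_mul_le x.natAbs y.natAbs
    simp only [Op.eval, Int.natAbs_mul]
    omega
  | div =>
    have := Nat.size_le_size (Int.natAbs_ediv_le_natAbs x y)
    simp only [Op.eval]
    omega
  | mod =>
    have : (x % y).natAbs ≤ x.natAbs ∨ (x % y).natAbs ≤ y.natAbs := by
      rcases eq_or_ne y 0 with rfl | h
      · simp
      · right
        have h₁ := Int.emod_nonneg x h
        have h₂ := Int.emod_lt_abs x h
        rw [Int.abs_eq_natAbs] at h₂
        omega
    simp only [Op.eval]
    rcases this with h | h
    · have := Nat.size_le_size h; omega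
    · have := Nat.size_le_size h; omega

/-- Every cell of the memory has absolute value at most `β`. -/
def Bdd (β : ℕ) (M : Memory) : Prop := ∀ a i, (M a i).natAbs ≤ β

theorem Bdd.write {β : ℕ} {M : Memory} (h : Bdd β M) (a : ℕ) (i : ℤ) {z : ℤ}
    (hz : z.natAbs ≤ β) : Bdd β (M.write a i z) := by
  intro b j
  rw [write_apply]
  split_ifs
  exacts [hz, h b j]

theorem one_le_wt (e : Expr) : 1 ≤ e.wt := by cases e <;> simp [Expr.wt]

theorem len_eval_le {β : ℕ} {M : Memory} (h : Bdd β M) (e : Expr) :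
    len (e.eval M) ≤ e.wt * (β.size + 1) := by
  induction e with
  | const z =>
    have := size_le_self z.natAbs
    simp only [Expr.eval, Expr.wt, len]
    nlinarith
  | cell a i ih =>
    have h₁ : len (M a (i.eval M)) ≤ β.size := Nat.size_le_size (h a _)
    simp only [Expr.eval, Expr.wt]
    nlinarith
  | op o e₁ e₂ ih₁ ih₂ =>
    have := len_op_le o (e₁.eval M) (e₂.eval M)
    simp only [Expr.eval, Expr.wt]
    nlinarith

/-- The lengths of values, and hence the cost, are controlled by the weight of the expression and
the bound on the contents of the memory. -/
theorem cost_le {β : ℕ} {M : Memory} (h : Bdd β M) (e : Expr) :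
    e.cost M ≤ (e.wt * (β.size + 1)) ^ 2 := by
  induction e with
  | const z =>
    have := size_le_self z.natAbs
    simp only [Expr.cost, Expr.wt, len]
    nlinarith [Nat.zero_le β.size, Nat.zero_le z.natAbs,
      Nat.zero_le ((1 + z.natAbs) * β.size)]
  | cell a i ih =>
    have h₁ : len (M a (i.eval M)) ≤ β.size := Nat.size_le_size (h a _)
    have h₂ := len_eval_le h i
    simp only [Expr.cost, Expr.wt]
    have h₃ := one_le_wt i
    generalize β.size = s at *
    calc _ ≤ (i.wt * (s + 1)) ^ 2 + 1 + i.wt * (s + 1) + s := by omega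
      _ ≤ _ := by nlinarith [Nat.zero_le s, Nat.zero_le (i.wt * s)]
  | op o e₁ e₂ ih₁ ih₂ =>
    have h₁ := len_eval_le h e₁
    have h₂ := len_eval_le h e₂
    simp only [Expr.cost, Expr.wt]
    generalize e₁.eval M = z₁ at *
    generalize e₂.eval M = z₂ at *
    have h₃ : (1 + len z₁) * (1 + len z₂) ≤
        (1 + e₁.wt * (β.size + 1)) * (1 + e₂.wt * (β.size + 1)) :=
      Nat.mul_le_mul (by omega) (by omega)
    have e : ((e₁.wt + e₂.wt + 1) * (β.size + 1)) ^ 2 =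
      (e₁.wt * (β.size + 1) + e₂.wt * (β.size + 1) + (β.size + 1)) ^ 2 := by ring
    rw [e]
    generalize e₁.wt * (β.size + 1) = x at *
    generalize e₂.wt * (β.size + 1) = y at *
    nlinarith [Nat.zero_le (x * β.size), Nat.zero_le (y * β.size), Nat.zero_le (x * y),
      Nat.zero_le (β.size ^ 2)]

/-! ### A Hoare logic with running times -/

/-- A bound for the cost of one elementary statement, all of whose expressions have weight at most
`40`, on a memory bounded by `β`. -/
def unit (β : ℕ) : ℕ := 8 * (40 * (β.size + 1)) ^ 2

theorem cost_add_len_le {β : ℕ} {M : Memory} (h : Bdd β M) {e : Expr} (hw : e.wt ≤ 40) :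
    2 * (e.cost M + 1 + len (e.eval M)) ≤ unit β := by
  have h₁ := cost_le h e
  have h₂ := len_eval_le h e
  have h₃ : e.wt * (β.size + 1) ≤ 40 * (β.size + 1) := Nat.mul_le_mul_right _ hw
  have h₄ : (e.wt * (β.size + 1)) ^ 2 ≤ (40 * (β.size + 1)) ^ 2 := Nat.pow_le_pow_left h₃ 2
  have h₅ : 40 * (β.size + 1) ≤ (40 * (β.size + 1)) ^ 2 := Nat.le_self_pow (by norm_num) _
  unfold unit
  omega

/-- Program `p`, started with memory `M`, halts within `n` elementary statements with a memory that
satisfies `Q` and is bounded by `β`, each statement being charged at most `unit β`. -/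
def Runs (β : ℕ) (p : Prog) (M : Memory) (n : ℕ) (Q : Memory → Prop) : Prop :=
  ∃ M' t, Exec p M M' t ∧ t ≤ n * unit β ∧ Bdd β M' ∧ Q M'

variable {β n n' : ℕ} {M : Memory} {p q : Prog} {Q Q' : Memory → Prop}

theorem Runs.mono (h : Runs β p M n Q) (hn : n ≤ n') (hQ : ∀ M', Bdd β M' → Q M' → Q' M') :
    Runs β p M n' Q' := by
  obtain ⟨M', t, h₁, h₂, h₃, h₄⟩ := h
  exact ⟨M', t, h₁, h₂.trans (Nat.mul_le_mul_right _ hn), h₃, hQ M' h₃ h₄⟩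

theorem one_le_unit (β : ℕ) : 1 ≤ unit β := by
  have : 0 < unit β := by unfold unit; positivity
  omega

theorem Runs.skip (hb : Bdd β M) (h : Q M) : Runs β .skip M 1 Q :=
  ⟨M, 1, .skip M, by simpa using one_le_unit β, hb, h⟩

theorem Runs.assign {a : ℕ} {i e : Expr} {iv ev : ℤ} (hb : Bdd β M)
    (hw : i.wt ≤ 40 ∧ e.wt ≤ 40) (hi : i.eval M = iv) (he : e.eval M = ev)
    (hev : ev.natAbs ≤ β) (h : Bdd β (M.write a iv ev) → Q (M.write a iv ev)) :
    Runs β (.assign a i e) M 1 Q := by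
  subst hi he
  refine ⟨_, _, .assign a i e M, ?_, hb.write _ _ hev, h (hb.write _ _ hev)⟩
  have h₁ := cost_add_len_le hb hw.1
  have h₂ := cost_add_len_le hb hw.2
  omega

theorem Runs.seq (hp : Runs β p M n Q) (hq : ∀ M', Bdd β M' → Q M' → Runs β q M' n' Q') :
    Runs β (.seq p q) M (n + n') Q' := by
  obtain ⟨M', t, h₁, h₂, h₃, h₄⟩ := hp
  obtain ⟨M'', t', h₁', h₂', h₃', h₄'⟩ := hq M' h₃ h₄
  exact ⟨M'', t + t', .seq h₁ h₁', by rw [Nat.add_mul]; omega, h₃', h₄'⟩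

/-- An assignment followed by another program. -/
theorem Runs.assign_seq {a : ℕ} {i e : Expr} (iv ev : ℤ) (hb : Bdd β M)
    (hw : i.wt ≤ 40 ∧ e.wt ≤ 40) (hi : i.eval M = iv) (he : e.eval M = ev)
    (hev : ev.natAbs ≤ β)
    (h : Bdd β (M.write a iv ev) → Runs β q (M.write a iv ev) n Q) :
    Runs β (.seq (.assign a i e) q) M (n + 1) Q := by
  rw [Nat.add_comm]
  exact Runs.seq (Q := fun M' => M' = M.write a iv ev)
    (Runs.assign hb hw hi he hev fun _ => rfl) fun M' hb' hM' => by subst hM'; exact h hb'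

theorem Runs.cond {e : Expr} (hb : Bdd β M) (hw : e.wt ≤ 40)
    (h₁ : 0 < e.eval M → Runs β p M n Q) (h₂ : e.eval M ≤ 0 → Runs β q M n Q) :
    Runs β (.cond e p q) M (n + 1) Q := by
  have h := cost_add_len_le hb hw
  rcases lt_or_ge 0 (e.eval M) with hpos | hpos
  · obtain ⟨M', t, k₁, k₂, k₃, k₄⟩ := h₁ hpos
    exact ⟨M', _, .cond_pos hpos k₁, by rw [Nat.add_mul]; omega, k₃, k₄⟩
  · obtain ⟨M', t, k₁, k₂, k₃, k₄⟩ := h₂ hpos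
    exact ⟨M', _, .cond_nonpos hpos k₁, by rw [Nat.add_mul]; omega, k₃, k₄⟩

/-- A loop with invariant `I` and variant `μ`: each round costs the `n` statements of the body and
one test, and one more test ends the loop. -/
theorem Runs.loop {e : Expr} (I : Memory → Prop) (μ : Memory → ℕ) (hb : Bdd β M)
    (hw : e.wt ≤ 40) (hI : I M)
    (step : ∀ M, Bdd β M → I M → 0 < e.eval M →
      Runs β p M n (fun M' => I M' ∧ μ M' < μ M)) :
    Runs β (.loop e p) M ((n + 1) * μ M + 1) (fun M' => I M' ∧ e.eval M' ≤ 0) := by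
  induction hk : μ M using Nat.strong_induction_on generalizing M with
  | _ k ih =>
  subst hk
  have h := cost_add_len_le hb hw
  rcases lt_or_ge 0 (e.eval M) with hpos | hpos
  · obtain ⟨M', t, k₁, k₂, k₃, k₄, k₅⟩ := step M hb hI hpos
    obtain ⟨M'', t', l₁, l₂, l₃, l₄⟩ := ih _ k₅ k₃ k₄ rfl
    refine ⟨M'', _, .loop_step hpos k₁ l₁, ?_, l₃, l₄⟩
    have h₁ : (n + 1) * (μ M' + 1) ≤ (n + 1) * μ M := Nat.mul_le_mul_left _ k₅
    have h₂ := Nat.mul_le_mul_right (unit β) h₁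
    simp only [Nat.add_mul, Nat.mul_add, Nat.mul_one, Nat.one_mul] at *
    omega
  · exact ⟨M, _, .loop_done hpos, by rw [Nat.add_mul]; omega, hb, hI, hpos⟩

/-- The loop `for v = s, …, l - 1 do p`, the counter being kept in cell `0` of array `v`. -/
def Prog.forUpTo (v : ℕ) (s l : Expr) (p : Prog) : Prog :=
  .seq (.assign v 0 s) (.loop (l - var v) (.seq p (.assign v 0 (var v + 1))))

/-- The rule for `forUpTo`, with an invariant `I k` which holds before the round with counter
value `k`. -/
theorem Runs.forUpTo {v : ℕ} {s l : Expr} (sv lv : ℕ) (I : ℕ → Memory → Prop) (hb : Bdd β M)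
    (hw : s.wt ≤ 36 ∧ l.wt ≤ 36) (hs : s.eval M = sv) (hsl : sv ≤ lv) (hl : lv ≤ β)
    (hI : I sv (M.write v 0 sv))
    (hlim : ∀ k M, I k M → l.eval M = lv)
    (step : ∀ k M, Bdd β M → sv ≤ k → k < lv → M v 0 = k → I k M →
      Runs β p M n (fun M' => M' v 0 = k ∧ I (k + 1) (M'.write v 0 (k + 1 : ℕ)))) :
    Runs β (.forUpTo v s l p) M ((n + 2) * lv + 2) (fun M' => M' v 0 = lv ∧ I lv M') := by
  refine Runs.assign_seq 0 sv hb ⟨by decide, by omega⟩ rfl hs (by omega) fun hb' => ?_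
  have hv : var v = Expr.cell v (.const 0) := rfl
  refine (Runs.loop (n := n + 1) (p := .seq p (.assign v 0 (var v + 1)))
    (fun M => ∃ k : ℕ, sv ≤ k ∧ k ≤ lv ∧ M v 0 = k ∧ I k M)
    (fun M => lv - (M v 0).toNat) hb' ?_ ⟨sv, le_rfl, hsl, by simp, hI⟩ ?_).mono ?_ ?_
  · have : (l - var v).wt = l.wt + 3 := rfl
    omega
  · rintro M hb ⟨k, h₁, h₂, h₃, h₄⟩ hpos
    simp only [eval_sub, hlim k M h₄, eval_cell, eval_zero, h₃] at hpos
    refine Runs.seq (step k M hb h₁ (by omega) h₃ h₄) fun M' hb' h => ?_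
    refine Runs.assign hb' ⟨by decide, (by decide : 5 ≤ 40)⟩ rfl
      (show _ = ((k + 1 : ℕ) : ℤ) by simp [h.1]) (by omega) fun _ => ?_
    exact ⟨⟨k + 1, by omega, by omega, by simp, h.2⟩, by simp [h₃]; omega⟩
  · have : (n + 1 + 1) * (lv - ((M.write v 0 sv) v 0).toNat) ≤ (n + 2) * lv :=
      Nat.mul_le_mul_left _ (Nat.sub_le _ _)
    omega
  · rintro M' _ ⟨⟨k, h₁, h₂, h₃, h₄⟩, h₅⟩
    simp only [eval_sub, hlim k M' h₄, eval_cell, eval_zero, h₃] at h₅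
    obtain rfl : k = lv := by omega
    exact ⟨h₃, h₄⟩

/-- The memories `M` and `M'` agree except for the arrays in `S`. -/
def Agree (S : List ℕ) (M M' : Memory) : Prop := ∀ a ∉ S, M' a = M a

theorem Agree.refl (S : List ℕ) (M : Memory) : Agree S M M := fun _ _ => rfl

theorem Agree.trans {S : List ℕ} {M M' M'' : Memory} (h : Agree S M M') (h' : Agree S M' M'') :
    Agree S M M'' := fun a ha => (h' a ha).trans (h a ha)

theorem Agree.mono {S S' : List ℕ} {M M' : Memory} (h : Agree S M M') (hS : S ⊆ S') :
    Agree S' M M' := fun a ha => h a fun h' => ha (hS h')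

theorem Agree.write {S : List ℕ} {M M' : Memory} (h : Agree S M M') {a : ℕ} (ha : a ∈ S)
    (i z : ℤ) : Agree S M (M'.write a i z) := fun b hb => by
  rw [write_of_ne _ _ _ (by rintro rfl; exact hb ha), h b hb]

end RAM

/-! ### Diagonalisation modulo `N` by two-line operations -/

namespace Diagonalization

/-- Replace rows `t` and `f` of `W` by the combinations with coefficients `(c₁, c₂)` and
`(c₃, c₄)` of these rows, reduced modulo `N`. -/
def rowOp (N c₁ c₂ c₃ c₄ : ℤ) (t f : ℕ) (W : ℕ → ℕ → ℤ) : ℕ → ℕ → ℤ := fun i j =>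
  if i = t then (c₁ * W t j + c₂ * W f j) % N
  else if i = f then (c₃ * W t j + c₄ * W f j) % N else W i j

/-- The same as `rowOp` for columns. -/
def colOp (N c₁ c₂ c₃ c₄ : ℤ) (t f : ℕ) (W : ℕ → ℕ → ℤ) : ℕ → ℕ → ℤ := fun i j =>
  if j = t then (c₁ * W i t + c₂ * W i f) % N
  else if j = f then (c₃ * W i t + c₄ * W i f) % N else W i j

/-- The linear form on `(ℤ / N)^d` given by row `i` of `W`. -/
def form (N : ℕ) {d : ℕ} (W : ℕ → ℕ → ℤ) (i : ℕ) (y : Fin d → ZMod N) : ZMod N :=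
  ∑ l : Fin d, (W i l : ZMod N) * y l

/-- The invariant of the diagonalisation: the first `n` rows of `W` form a matrix `B`, the next `d`
rows form a square matrix `V`, the columns of `V` span `(ℤ / N)^d`, and `V` maps the kernel
of `B` onto `K`. All entries are reduced modulo `N`. -/
structure Inv (N n d : ℕ) (K : AddSubgroup (Fin d → ZMod N)) (W : ℕ → ℕ → ℤ) : Prop where
  nonneg : ∀ i j, i < n + d → j < d → 0 ≤ W i j
  lt : ∀ i j, i < n + d → j < d → W i j < N
  span : ∀ x : Fin d → ZMod N, ∃ y : Fin d → ZMod N, ∀ i : Fin d, form N W (n + i) y = x i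
  ker : ∀ y : Fin d → ZMod N,
    (∀ i < n, form N W i y = 0) ↔ (fun i : Fin d => form N W (n + i) y) ∈ K

/-- The first `t` rows and columns of `B` vanish off the diagonal. -/
def Diag (n d t : ℕ) (W : ℕ → ℕ → ℤ) : Prop :=
  ∀ i j, i < n → j < d → i ≠ j → i < t ∨ j < t → W i j = 0

variable {N n d t f : ℕ} {K : AddSubgroup (Fin d → ZMod N)} {W W' : ℕ → ℕ → ℤ}

theorem form_congr {i : ℕ} (h : ∀ j < d, W' i j = W i j) (y : Fin d → ZMod N) :
    form N W' i y = form N W i y :=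
  Finset.sum_congr rfl fun l _ => by rw [h l l.2]

theorem Inv.congr (h : Inv N n d K W) (hW : ∀ i j, i < n + d → j < d → W' i j = W i j) :
    Inv N n d K W' := by
  have hf : ∀ i, i < n + d → ∀ y : Fin d → ZMod N, form N W' i y = form N W i y :=
    fun i hi y => form_congr (fun j hj => hW i j hi hj) y
  refine ⟨fun i j hi hj => hW i j hi hj ▸ h.nonneg i j hi hj,
    fun i j hi hj => hW i j hi hj ▸ h.lt i j hi hj, fun x => ?_, fun y => ?_⟩
  · obtain ⟨y, hy⟩ := h.span x
    exact ⟨y, fun i => by rw [hf _ (by omega), hy]⟩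
  · have e : (fun i : Fin d => form N W' (n + i) y) = fun i : Fin d => form N W (n + i) y :=
      funext fun i => hf _ (by omega) y
    rw [e, ← h.ker y]
    exact forall₂_congr fun i hi => by rw [hf i (by omega)]

theorem Diag.congr (h : Diag n d t W) (hW : ∀ i j, i < n → j < d → W' i j = W i j) :
    Diag n d t W' := fun i j hi hj hne hor => by rw [hW i j hi hj, h i j hi hj hne hor]

variable {c₁ c₂ c₃ c₄ e : ℤ}

theorem form_rowOp_fst (y : Fin d → ZMod N) :
    form N (rowOp N c₁ c₂ c₃ c₄ t f W) t y = c₁ * form N W t y + c₂ * form N W f y := by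
  simp only [form, rowOp, if_true, Finset.mul_sum, ← Finset.sum_add_distrib]
  refine Finset.sum_congr rfl fun l _ => ?_
  push_cast [ZMod.intCast_mod]
  ring

theorem form_rowOp_snd (htf : t ≠ f) (y : Fin d → ZMod N) :
    form N (rowOp N c₁ c₂ c₃ c₄ t f W) f y = c₃ * form N W t y + c₄ * form N W f y := by
  simp only [form, rowOp, if_true, if_neg htf.symm, Finset.mul_sum, ← Finset.sum_add_distrib]
  refine Finset.sum_congr rfl fun l _ => ?_
  push_cast [ZMod.intCast_mod]
  ring

theorem form_rowOp_of_ne {i : ℕ} (h₁ : i ≠ t) (h₂ : i ≠ f) (y : Fin d → ZMod N) :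
    form N (rowOp N c₁ c₂ c₃ c₄ t f W) i y = form N W i y :=
  form_congr (fun j _ => by simp [rowOp, h₁, h₂]) y

/-- A row operation on `B` with determinant `e = ± 1` preserves the kernel of `B`. -/
theorem Inv.rowOp (h : Inv N n d K W) (hN : 0 < N) (ht : t < n) (hf : f < n) (htf : t ≠ f)
    (hdet : c₁ * c₄ - c₂ * c₃ = e) (he : e * e = 1) :
    Inv N n d K (rowOp N c₁ c₂ c₃ c₄ t f W) := by
  have hN' : (0 : ℤ) < N := by exact_mod_cast hN
  refine ⟨fun i j hi hj => ?_, fun i j hi hj => ?_, fun x => ?_, fun y => ?_⟩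
  · simp only [Diagonalization.rowOp]
    split_ifs
    exacts [Int.emod_nonneg _ hN'.ne', Int.emod_nonneg _ hN'.ne', h.nonneg i j hi hj]
  · simp only [Diagonalization.rowOp]
    split_ifs
    exacts [Int.emod_lt_of_pos _ hN', Int.emod_lt_of_pos _ hN', h.lt i j hi hj]
  · obtain ⟨y, hy⟩ := h.span x
    exact ⟨y, fun i => by rw [form_rowOp_of_ne (by omega) (by omega), hy]⟩
  · have e' : (fun i : Fin d => form N (Diagonalization.rowOp N c₁ c₂ c₃ c₄ t f W) (n + i) y) =
        fun i : Fin d => form N W (n + i) y :=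
      funext fun i => form_rowOp_of_ne (by omega) (by omega) y
    rw [e', ← h.ker y]
    constructor
    · intro hy
      have h₁ := hy t ht
      have h₂ := hy f hf
      rw [form_rowOp_fst] at h₁
      rw [form_rowOp_snd htf] at h₂
      have hd : (c₁ : ZMod N) * c₄ - c₂ * c₃ = e := by exact_mod_cast congrArg (Int.cast : ℤ → ZMod N) hdet
      have hee : (e : ZMod N) * e = 1 := by exact_mod_cast congrArg (Int.cast : ℤ → ZMod N) he
      intro i hi
      by_cases hit : i = t
      · subst hit
        linear_combination (e : ZMod N) * c₄ * h₁ - e * c₂ * h₂ - form N W i y * e * hd -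
          form N W i y * hee
      by_cases hif : i = f
      · subst hif
        linear_combination (e : ZMod N) * c₁ * h₂ - e * c₃ * h₁ - form N W i y * e * hd -
          form N W i y * hee
      rw [← hy i hi, form_rowOp_of_ne hit hif]
    · intro hy i hi
      by_cases hit : i = t
      · subst hit; rw [form_rowOp_fst, hy _ ht, hy _ hf]; simp
      by_cases hif : i = f
      · subst hif; rw [form_rowOp_snd htf, hy _ ht, hy _ hf]; simp
      rw [form_rowOp_of_ne hit hif, hy i hi]

/-- The substitution of variables which corresponds to a column operation. -/
def colSubst (c₁ c₂ c₃ c₄ : ℤ) (t f : Fin d) (y : Fin d → ZMod N) : Fin d → ZMod N := fun l =>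
  if l = t then c₁ * y t + c₃ * y f else if l = f then c₂ * y t + c₄ * y f else y l

theorem form_colOp {t f : Fin d} (htf : t ≠ f) (i : ℕ) (y : Fin d → ZMod N) :
    form N (colOp N c₁ c₂ c₃ c₄ t f W) i y = form N W i (colSubst c₁ c₂ c₃ c₄ t f y) := by
  rw [← sub_eq_zero, form, form, ← Finset.sum_sub_distrib, Fintype.sum_eq_add t f htf]
  · have h : (f : ℕ) ≠ t := fun h => htf (Fin.ext h.symm)
    simp only [colOp, colSubst, if_true, if_neg htf.symm, if_neg h]
    push_cast [ZMod.intCast_mod]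
    ring
  · rintro l ⟨h₁, h₂⟩
    have h₁' : (l : ℕ) ≠ t := fun h => h₁ (Fin.ext h)
    have h₂' : (l : ℕ) ≠ f := fun h => h₂ (Fin.ext h)
    simp [colOp, colSubst, h₁, h₂, h₁', h₂']

theorem colSubst_surjective {t f : Fin d} (htf : t ≠ f) (hdet : c₁ * c₄ - c₂ * c₃ = e)
    (he : e * e = 1) :
    Function.Surjective (colSubst (N := N) c₁ c₂ c₃ c₄ t f) := by
  intro y
  have hd : (c₁ : ZMod N) * c₄ - c₂ * c₃ = e := by exact_mod_cast congrArg (Int.cast : ℤ → ZMod N) hdet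
  have hee : (e : ZMod N) * e = 1 := by exact_mod_cast congrArg (Int.cast : ℤ → ZMod N) he
  refine ⟨fun l => if l = t then e * (c₄ * y t - c₃ * y f)
    else if l = f then e * (c₁ * y f - c₂ * y t) else y l, funext fun l => ?_⟩
  by_cases hlt : l = t
  · subst hlt
    simp only [Diagonalization.colSubst, if_true, if_neg htf.symm]
    linear_combination (e : ZMod N) * y l * hd + y l * hee
  by_cases hlf : l = f
  · subst hlf
    simp only [Diagonalization.colSubst, if_true, if_neg htf.symm]
    linear_combination (e : ZMod N) * y l * hd + y l * hee
  simp [Diagonalization.colSubst, hlt, hlf]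

/-- A column operation with determinant `e = ± 1` on all rows amounts to an invertible
substitution of variables. -/
theorem Inv.colOp (h : Inv N n d K W) (hN : 0 < N) (ht : t < d) (hf : f < d) (htf : t ≠ f)
    (hdet : c₁ * c₄ - c₂ * c₃ = e) (he : e * e = 1) :
    Inv N n d K (colOp N c₁ c₂ c₃ c₄ t f W) := by
  have hN' : (0 : ℤ) < N := by exact_mod_cast hN
  have htf' : (⟨t, ht⟩ : Fin d) ≠ ⟨f, hf⟩ := fun h => htf (Fin.mk.inj_iff.1 h)
  have hform := fun i (y : Fin d → ZMod N) =>
    form_colOp (N := N) (c₁ := c₁) (c₂ := c₂) (c₃ := c₃) (c₄ := c₄) (W := W) htf' i y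
  refine ⟨fun i j hi hj => ?_, fun i j hi hj => ?_, fun x => ?_, fun y => ?_⟩
  · simp only [Diagonalization.colOp]
    split_ifs
    exacts [Int.emod_nonneg _ hN'.ne', Int.emod_nonneg _ hN'.ne', h.nonneg i j hi hj]
  · simp only [Diagonalization.colOp]
    split_ifs
    exacts [Int.emod_lt_of_pos _ hN', Int.emod_lt_of_pos _ hN', h.lt i j hi hj]
  · obtain ⟨y, hy⟩ := h.span x
    obtain ⟨z, rfl⟩ := colSubst_surjective htf' hdet he y
    exact ⟨z, fun i => by rw [hform, hy]⟩
  · simp only [hform]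
    exact h.ker _

theorem Diag.rowOp (h : Diag n d t W) (hf : f < n) (htf : t < f) :
    Diag n d t (rowOp N c₁ c₂ c₃ c₄ t f W) := by
  intro i j hi hj hne hor
  have h₁ : ∀ i', i' < n → j < t → t ≤ i' → W i' j = 0 := fun i' hi' hjt hti =>
    h i' j hi' hj (by omega) (Or.inr hjt)
  simp only [Diagonalization.rowOp]
  split_ifs with h₂ h₃
  · rw [h₁ t (by omega) (by omega) le_rfl, h₁ f hf (by omega) htf.le]; simp
  · rw [h₁ t (by omega) (by omega) le_rfl, h₁ f hf (by omega) htf.le]; simp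
  · exact h i j hi hj hne hor

theorem Diag.transpose (h : Diag n d t W) : Diag d n t (fun i j => W j i) :=
  fun i j hi hj hne hor => h j i hj hi hne.symm hor.symm

theorem Diag.colOp (h : Diag n d t W) (hf : f < d) (htf : t < f) :
    Diag n d t (colOp N c₁ c₂ c₃ c₄ t f W) :=
  (h.transpose.rowOp (N := N) (c₁ := c₁) (c₂ := c₂) (c₃ := c₃) (c₄ := c₄) hf htf).transpose

/-- The positive representative in `{1, …, N}` of a reduced entry, as a natural number. -/
def posRep (N : ℕ) (x : ℤ) : ℕ := if x = 0 then N else x.natAbs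

/-- The coefficients have determinant `± 1`, and the combination with coefficients `(c₁, c₂)` of
the pivot `x` and the entry `y` has smaller binary length than `x`, unless the pivot is kept
and the entry is eliminated. -/
def Reduces (N x y c₁ c₂ c₃ c₄ : ℤ) : Prop :=
  (∃ e, c₁ * c₄ - c₂ * c₃ = e ∧ e * e = 1) ∧
  ((c₁ = 1 ∧ c₂ = 0 ∧ (c₃ * x + c₄ * y) % N = 0) ∨
    (posRep N.natAbs ((c₁ * x + c₂ * y) % N)).size < (posRep N.natAbs x).size)

theorem size_lt_size {a b : ℕ} (ha : 0 < a) (h : 2 * a ≤ b) : a.size < b.size := by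
  have h₁ : a.size - 1 < a.size := Nat.sub_lt (Nat.size_pos.2 ha) one_pos
  have h₂ := Nat.lt_size.1 h₁
  have h₃ : 2 ^ a.size = 2 * 2 ^ (a.size - 1) := by
    rw [← pow_succ', Nat.sub_add_cancel (Nat.size_pos.2 ha)]
  exact Nat.lt_size.2 (by omega)

/-- Division of `y` by the positive representative `a` of `x` with the remainder `r = y - q a` of
least absolute value. -/
theorem reduces_of_balanced {x y a q r : ℤ} (hN : 0 < N) (hx : 0 ≤ x) (hxN : x < N)
    (ha : a = if 0 < x then x else N) (hq : q = (2 * y + a) / (2 * a)) (hr : r = y - q * a) :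
    (0 < r → Reduces N x y (-q) 1 1 0) ∧ (r < 0 → Reduces N x y q (-1) 1 0) ∧
    (r = 0 → Reduces N x y 1 0 (-q) 1) ∧ 0 < a ∧ a ≤ N ∧ -a ≤ 2 * r ∧ 2 * r ≤ a := by
  have ha0 : 0 < a ∧ a ≤ N := by split_ifs at ha <;> omega
  have hmod : ∃ k : ℤ, a = x + N * k := by
    split_ifs at ha
    · exact ⟨0, by omega⟩
    · exact ⟨1, by omega⟩
  have hrep : (posRep N x : ℤ) = a := by
    unfold posRep
    split_ifs at ha ⊢ <;> omega
  obtain ⟨k, hk⟩ := hmod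
  have h₁ := Int.mul_ediv_add_emod (2 * y + a) (2 * a)
  have h₂ := Int.emod_nonneg (2 * y + a) (show 2 * a ≠ 0 by omega)
  have h₃ := Int.emod_lt_of_pos (2 * y + a) (show 0 < 2 * a by omega)
  rw [← hq] at h₁
  have h₄ : 2 * a * q = 2 * (q * a) := by ring
  have hb : -a ≤ 2 * r ∧ 2 * r ≤ a := by omega
  have key : ∀ {s z : ℤ}, 0 < s → 2 * s ≤ a → s < N → z % N = s →
      (posRep N (z % N)).size < (posRep N x).size := by
    intro s z hs hsa hsN hz
    rw [hz]
    refine size_lt_size ?_ ?_ <;> simp only [posRep, if_neg hs.ne'] at * <;> omega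
  refine ⟨fun h => ⟨⟨_, rfl, by ring⟩, Or.inr ?_⟩, fun h => ⟨⟨_, rfl, by ring⟩, Or.inr ?_⟩,
    fun h => ⟨⟨_, rfl, by ring⟩, Or.inl ⟨rfl, rfl, ?_⟩⟩, ha0.1, ha0.2, hb⟩
  · refine key h hb.2 (by omega) ?_
    have : -q * x + 1 * y = r + N * (q * k) := by rw [hr, hk]; ring
    rw [this, Int.add_mul_emod_self_left, Int.emod_eq_of_lt h.le (by omega)]
  · refine key (s := -r) (by omega) (by omega) (by omega) ?_
    have : q * x + -1 * y = -r + N * (-(q * k)) := by rw [hr, hk]; ring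
    rw [this, Int.add_mul_emod_self_left, Int.emod_eq_of_lt (by omega) (by omega)]
  · have : -q * x + 1 * y = 0 + N * (q * k) := by rw [← h, hr, hk]; ring
    rw [this, Int.add_mul_emod_self_left, Int.zero_emod]

/-- The potential of the `t`-th phase: the length of the pivot, weighted, plus the number of entries
still to be eliminated in the row and the column of the pivot. -/
def potential (N n d t : ℕ) (W : ℕ → ℕ → ℤ) : ℕ :=
  (n + d + 1) * (posRep N (W t t)).size +
    ({i ∈ Finset.range n | t < i ∧ W i t ≠ 0}.card +
      {j ∈ Finset.range d | t < j ∧ W t j ≠ 0}.card)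

theorem card_filter_range_le (n : ℕ) (P : ℕ → Prop) [DecidablePred P] :
    {i ∈ Finset.range n | P i}.card ≤ n :=
  (Finset.card_filter_le _ _).trans (Finset.card_range n).le

theorem potential_transpose : potential N d n t (fun i j => W j i) = potential N n d t W := by
  unfold potential
  rw [Nat.add_comm d n]
  dsimp only
  omega

theorem potential_congr (ht : t < n) (htd : t < d) (hW : ∀ i j, i < n → j < d → W' i j = W i j) :
    potential N n d t W' = potential N n d t W := by
  unfold potential
  rw [hW t t ht htd]
  congr 3
  · refine Finset.filter_congr fun i hi => ?_
    rw [hW i t (Finset.mem_range.1 hi) htd]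
  · refine Finset.filter_congr fun i hi => ?_
    rw [hW t i ht (Finset.mem_range.1 hi)]

theorem potential_le (h₀ : 0 ≤ W t t) (h₁ : W t t < N) :
    potential N n d t W ≤ (n + d + 1) * (N.size + 1) := by
  have h₂ := card_filter_range_le n (fun i => t < i ∧ W i t ≠ 0)
  have h₃ := card_filter_range_le d (fun j => t < j ∧ W t j ≠ 0)
  have h₄ : (posRep N (W t t)).size ≤ N.size := by
    refine Nat.size_le_size ?_
    unfold posRep
    split_ifs <;> omega
  have h₅ := Nat.mul_le_mul_left (n + d + 1) h₄
  unfold potential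
  rw [Nat.mul_add]
  omega

theorem potential_rowOp (hred : Reduces N (W t t) (W f t) c₁ c₂ c₃ c₄)
    (hrow : ∀ j < d, 0 ≤ W t j ∧ W t j < N) (ht : t < d) (hf : f < n) (htf : t < f)
    (hft : W f t ≠ 0) :
    potential N n d t (rowOp N c₁ c₂ c₃ c₄ t f W) < potential N n d t W := by
  obtain ⟨-, ⟨rfl, rfl, h⟩ | h⟩ := hred
  · have h₁ : ∀ j < d, rowOp N 1 0 c₃ c₄ t f W t j = W t j := fun j hj => by
      simp [rowOp, Int.emod_eq_of_lt (hrow j hj).1 (hrow j hj).2]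
    have h₂ : rowOp N 1 0 c₃ c₄ t f W f t = 0 := by simp [rowOp, htf.ne', h]
    unfold potential
    rw [h₁ t ht]
    refine Nat.add_lt_add_left (Nat.add_lt_add_of_lt_of_le (Finset.card_lt_card ?_)
      (Finset.card_le_card ?_)) _
    · refine (Finset.ssubset_iff_of_subset ?_).2 ⟨f, ?_, ?_⟩
      · intro i
        simp only [Finset.mem_filter, Finset.mem_range]
        rintro ⟨h₃, h₄, h₅⟩
        have hif : i ≠ f := by rintro rfl; exact h₅ h₂
        simp only [rowOp, if_neg h₄.ne', if_neg hif] at h₅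
        exact ⟨h₃, h₄, h₅⟩
      · simp [hf, htf, hft]
      · simp [h₂]
    · intro j
      simp only [Finset.mem_filter, Finset.mem_range]
      rintro ⟨h₃, h₄, h₅⟩
      rw [h₁ j h₃] at h₅
      exact ⟨h₃, h₄, h₅⟩
  · rw [Int.natAbs_natCast] at h
    have e : rowOp N c₁ c₂ c₃ c₄ t f W t t = (c₁ * W t t + c₂ * W f t) % N := by simp [rowOp]
    have h₂ := card_filter_range_le n (fun i => t < i ∧ rowOp N c₁ c₂ c₃ c₄ t f W i t ≠ 0)
    have h₃ := card_filter_range_le d (fun j => t < j ∧ rowOp N c₁ c₂ c₃ c₄ t f W t j ≠ 0)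
    have h₄ := Nat.mul_le_mul_left (n + d + 1) (Nat.succ_le_of_lt h)
    unfold potential
    rw [e]
    simp only [Nat.succ_eq_add_one, Nat.mul_add] at h₄
    omega

theorem potential_colOp (hred : Reduces N (W t t) (W t f) c₁ c₂ c₃ c₄)
    (hcol : ∀ i < n, 0 ≤ W i t ∧ W i t < N) (ht : t < n) (hf : f < d) (htf : t < f)
    (hft : W t f ≠ 0) :
    potential N n d t (colOp N c₁ c₂ c₃ c₄ t f W) < potential N n d t W := by
  rw [← potential_transpose (W := W), ← potential_transpose (W := colOp _ _ _ _ _ _ _ W)]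
  exact potential_rowOp (W := fun i j => W j i) hred hcol ht hf htf hft

/-! ### Kernel of a diagonal matrix modulo `N` -/

theorem intCast_mul_eq_zero_iff (hN : 0 < N) (w : ℤ) (y : ZMod N) :
    (w : ZMod N) * y = 0 ↔ ∃ z : ℤ, y = z * ((N / (Int.gcd w N : ℤ) : ℤ) : ZMod N) := by
  obtain ⟨k, rfl⟩ := ZMod.intCast_surjective y
  have hg : 0 < Int.gcd w N := Int.gcd_pos_of_ne_zero_right _ (by omega)
  obtain ⟨w', hw⟩ := Int.gcd_dvd_left w (N : ℤ)
  obtain ⟨g, hg'⟩ := Int.gcd_dvd_right w (N : ℤ)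
  have hcop : Int.gcd g w' = 1 := by
    have h := Int.gcd_div_gcd_div_gcd (i := w) (j := (N : ℤ)) hg
    rw [Int.ediv_eq_of_eq_mul_right (by omega) hw, Int.ediv_eq_of_eq_mul_right (by omega) hg'] at h
    rwa [Int.gcd_comm]
  rw [Int.ediv_eq_of_eq_mul_right (by omega) hg']
  have hG : ((Int.gcd w N : ℕ) : ℤ) ≠ 0 := by omega
  generalize ((Int.gcd w N : ℕ) : ℤ) = G at *
  constructor
  · intro h
    rw [← Int.cast_mul, ZMod.intCast_zmod_eq_zero_iff_dvd, hw, hg', mul_assoc] at h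
    obtain ⟨z, hz⟩ :=
      Int.dvd_of_dvd_mul_right_of_gcd_one (Int.dvd_of_mul_dvd_mul_left hG h) hcop
    exact ⟨z, by rw [hz]; push_cast; ring⟩
  · rintro ⟨z, hz⟩
    rw [hz, hw, ← Int.cast_mul, ← Int.cast_mul, ZMod.intCast_zmod_eq_zero_iff_dvd, hg']
    exact ⟨w' * z, by ring⟩

/-- The generators of the kernel which are read off from a diagonal matrix `B`. -/
def generator (N n : ℕ) {d : ℕ} (W : ℕ → ℕ → ℤ) (l : Fin d) : Fin d → ZMod N := fun i =>
  (((N / (Int.gcd (W l l) N : ℤ)) * W (n + i) l : ℤ) : ZMod N)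

theorem sum_zsmul_generator (z : Fin d → ℤ) :
    (∑ l, z l • generator N n W l) = fun i : Fin d => form N W (n + i)
      fun l => (z l : ZMod N) * ((N / (Int.gcd (W l l) N : ℤ) : ℤ) : ZMod N) := by
  funext i
  simp only [Finset.sum_apply, form]
  refine Finset.sum_congr rfl fun l _ => ?_
  rw [Pi.smul_apply, zsmul_eq_mul, generator, Int.cast_mul]
  ring

theorem form_diag (h : Diag n d d W) (l : Fin d) (hl : (l : ℕ) < n) (y : Fin d → ZMod N) :
    form N W l y = (W l l : ZMod N) * y l := by
  refine Fintype.sum_eq_single l fun j hj => ?_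
  rw [h l j hl j.2 (fun h => hj (Fin.ext h.symm)) (Or.inr j.2)]
  simp

theorem ker_diag (hN : 0 < N) (hdn : d ≤ n) (hW : Inv N n d K W) (h : Diag n d d W)
    (y : Fin d → ZMod N) :
    (fun i : Fin d => form N W (n + i) y) ∈ K ↔
      ∃ z : Fin d → ℤ,
        y = fun l => (z l : ZMod N) * ((N / (Int.gcd (W l l) N : ℤ) : ℤ) : ZMod N) := by
  rw [← hW.ker]
  have h₁ : (∀ i < n, form N W i y = 0) ↔ ∀ l : Fin d, (W l l : ZMod N) * y l = 0 := by
    constructor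
    · intro hy l
      rw [← form_diag h l (by omega), hy l (by omega)]
    · intro hy i hi
      by_cases hid : i < d
      · rw [show i = ((⟨i, hid⟩ : Fin d) : ℕ) from rfl, form_diag h _ hi]
        exact hy ⟨i, hid⟩
      · refine Finset.sum_eq_zero fun l _ => ?_
        rw [h i l hi l.2 (by omega) (Or.inr l.2)]
        simp
  simp only [h₁, intCast_mul_eq_zero_iff hN, funext_iff]
  exact Classical.skolem

theorem closure_generator (hN : 0 < N) (hdn : d ≤ n) (hW : Inv N n d K W) (h : Diag n d d W) :
    AddSubgroup.closure (Set.range (generator N n W)) = K := by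
  apply le_antisymm
  · rw [AddSubgroup.closure_le]
    rintro _ ⟨l, rfl⟩
    have h₁ := (ker_diag hN hdn hW h fun k => ((Pi.single l 1 : Fin d → ℤ) k : ZMod N) *
      ((N / (Int.gcd (W k k) N : ℤ) : ℤ) : ZMod N)).2 ⟨Pi.single l 1, rfl⟩
    rw [← sum_zsmul_generator, Fintype.sum_eq_single l fun j hj => by simp [hj]] at h₁
    simpa using h₁
  · intro x hx
    obtain ⟨y, hy⟩ := hW.span x
    obtain rfl : (fun i : Fin d => form N W (n + i) y) = x := funext hy
    obtain ⟨z, rfl⟩ := (ker_diag hN hdn hW h y).1 hx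
    rw [← sum_zsmul_generator]
    exact sum_mem fun l _ => zsmul_mem (AddSubgroup.subset_closure (Set.mem_range_self l)) _

/-- Since `(ℤ / N)^d` is finite, the columns of `V` are also linearly independent. -/
theorem Inv.injective (hN : 0 < N) (hW : Inv N n d K W) :
    Function.Injective fun (y : Fin d → ZMod N) (i : Fin d) => form N W (n + i) y := by
  have : NeZero N := ⟨hN.ne'⟩
  refine Finite.injective_iff_surjective.2 fun x => ?_
  obtain ⟨y, hy⟩ := hW.span x
  exact ⟨y, funext hy⟩

theorem generator_independent (hN : 0 < N) (hW : Inv N n d K W) :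
    iSupIndep fun l : Fin d => AddSubgroup.zmultiples (generator N n W l) := by
  apply iSupIndep_of_dfinsuppSumAddHom_injective'
  rw [injective_iff_map_eq_zero]
  intro u hu
  have h₁ : ∀ l, ∃ z : ℤ, z • generator N n W l = u l := fun l => (u l).2
  choose z hz using h₁
  have h₂ : ∑ l, z l • generator N n W l = 0 := by
    rw [← hu, DFinsupp.sumAddHom_apply, DFinsupp.sum_eq_sum_fintype]
    · exact Finset.sum_congr rfl fun l _ => hz l
    · simp
  rw [sum_zsmul_generator] at h₂
  have h₃ := hW.injective hN (a₁ := fun l => _) (a₂ := 0) (h₂.trans (by funext i; simp [form]))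
  ext l i
  have h₄ := congrFun h₃ l
  simp only [Pi.zero_apply] at h₄
  rw [← hz l]
  simp only [Pi.smul_apply, generator, zsmul_eq_mul, Int.cast_mul, ← mul_assoc, h₄]
  simp

/-- An independent generating family gives a decomposition into cyclic groups. -/
theorem nonempty_addEquiv_directSum {Γ : Type*} [AddCommGroup Γ] {ι : Type*} [Fintype ι]
    [DecidableEq ι] (K : AddSubgroup Γ) (h : ι → Γ) (hK : AddSubgroup.closure (Set.range h) = K)
    (hind : iSupIndep fun i => AddSubgroup.zmultiples (h i)) :
    Nonempty (K ≃+ ⨁ i, ZMod (Nat.card (AddSubgroup.zmultiples (h i)))) := by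
  let φ : (⨁ i, AddSubgroup.zmultiples (h i)) →+ Γ :=
    DFinsupp.sumAddHom fun i => (AddSubgroup.zmultiples (h i)).subtype
  have hφ : Function.Injective φ := hind.dfinsuppSumAddHom_injective
  have hr : φ.range = K := by
    rw [← hK]
    apply le_antisymm
    · rintro _ ⟨u, rfl⟩
      refine dfinsuppSumAddHom_mem _ _ _ fun i _ => ?_
      exact (AddSubgroup.zmultiples_le_of_mem (AddSubgroup.subset_closure (Set.mem_range_self i))) (u i).2
    · rw [AddSubgroup.closure_le]
      rintro _ ⟨i, rfl⟩
      exact ⟨DFinsupp.single i ⟨h i, AddSubgroup.mem_zmultiples _⟩, DFinsupp.sumAddHom_single _ _ _⟩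
  have e₁ := (AddMonoidHom.ofInjective hφ).trans (AddEquiv.addSubgroupCongr hr)
  have e₂ : (⨁ i, ZMod (Nat.card (AddSubgroup.zmultiples (h i)))) ≃+
      ⨁ i, AddSubgroup.zmultiples (h i) :=
    DFinsupp.mapRange.addEquiv fun i => zmodAddCyclicAddEquiv inferInstance
  exact ⟨(e₂.trans e₁).symm⟩

end Diagonalization

/-! ### The elimination programs

Array `1` holds the matrix `W` of the invariant, row by row. The scalar variables, which are cells `0`
of arrays, are used as follows: `4` is the modulus `N`, `5` the number `n = m + d` of rows of
`B`, `6` the current phase `t`, `7`, `17` and `26` are loop counters, `8` is the result of a search,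
`9`, …, `12` are the coefficients of a two-line operation, `13`, …, `16` describe its lines, `18`, `19`,
`24`, `25` hold quotient, remainder, divisor and dividend of the balanced division, `20` is the
flag of the elimination loop and `21` a temporary. The output phase reuses `22`, …, `25` for
Euclid's algorithm and the factor `N / gcd`. -/

namespace NullGen

open RAM Diagonalization

/-- Apply the `2 × 2` matrix of coefficients in the variables `9`, …, `12` to the lines of array `1`
that start at the addresses in variables `13` and `14`, with stride and number of entries in
variables `15` and `16`, modulo the variable `4`. -/
def line : Prog :=
  .forUpTo 7 0 (var 16)
    (.seq (.assign 21 0 (.cell 1 (var 13 + var 7 * var 15)))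
      (.seq
        (.assign 1 (var 13 + var 7 * var 15)
          ((var 9 * var 21 + var 10 * .cell 1 (var 14 + var 7 * var 15)) % var 4))
        (.assign 1 (var 14 + var 7 * var 15)
          ((var 11 * var 21 + var 12 * .cell 1 (var 14 + var 7 * var 15)) % var 4))))

variable {β N n d m t f : ℕ} {M M₀ : Memory}

theorem natAbs_emod_le (hN : 0 < N) (hNβ : N ≤ β) (z : ℤ) : (z % (N : ℤ)).natAbs ≤ β := by
  have h₁ := Int.emod_nonneg z (show (N : ℤ) ≠ 0 by omega)
  have h₂ := Int.emod_lt_of_pos z (show (0 : ℤ) < N by omega)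
  omega

theorem runs_line (hb : Bdd β M) (hN : 0 < N) (hNβ : N ≤ β) {p p' s c₁ c₂ c₃ c₄ : ℤ} {c : ℕ}
    (hcβ : c ≤ β) (h4 : M 4 0 = N) (h9 : M 9 0 = c₁) (h10 : M 10 0 = c₂) (h11 : M 11 0 = c₃)
    (h12 : M 12 0 = c₄) (h13 : M 13 0 = p) (h14 : M 14 0 = p') (h15 : M 15 0 = s)
    (h16 : M 16 0 = c) (hs : 0 < s)
    (hdisj : ∀ k k' : ℕ, k < c → k' < c → p + k * s ≠ p' + k' * s) :
    Runs β line M (5 * c + 2) fun M' => Agree [1, 7, 21] M M' ∧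
      (∀ k : ℕ, k < c →
        M' 1 (p + k * s) = (c₁ * M 1 (p + k * s) + c₂ * M 1 (p' + k * s)) % N ∧
        M' 1 (p' + k * s) = (c₃ * M 1 (p + k * s) + c₄ * M 1 (p' + k * s)) % N) ∧
      ∀ z, (∀ k : ℕ, k < c → z ≠ p + k * s ∧ z ≠ p' + k * s) → M' 1 z = M 1 z := by
  refine (Runs.forUpTo (n := 3) 0 c (fun k M' => Agree [1, 7, 21] M M' ∧
      (∀ j : ℕ, j < k →
        M' 1 (p + j * s) = (c₁ * M 1 (p + j * s) + c₂ * M 1 (p' + j * s)) % N ∧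
        M' 1 (p' + j * s) = (c₃ * M 1 (p + j * s) + c₄ * M 1 (p' + j * s)) % N) ∧
      ∀ z, (∀ j : ℕ, j < k → z ≠ p + j * s ∧ z ≠ p' + j * s) → M' 1 z = M 1 z)
    hb ⟨by decide, by decide⟩ rfl (Nat.zero_le _) hcβ ?_ ?_ ?_).mono le_rfl fun M' _ h => h.2
  · exact ⟨(Agree.refl _ M).write (by decide) _ _, by simp, fun z _ => by simp [write_apply]⟩
  · rintro k M' ⟨hA, -⟩
    simp [hA 16 (by decide), h16]
  · rintro k M' hb' - hk hk7 ⟨hA, hd, hr⟩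
    have hne : ∀ j : ℕ, j ≠ k → (j : ℤ) * s ≠ k * s := fun j hj h =>
      hj (by exact_mod_cast mul_right_cancel₀ hs.ne' h)
    -- The two cells of position `k` have not been touched yet.
    have v₁ : M' 1 (p + k * s) = M 1 (p + k * s) := hr _ fun j hj =>
      ⟨fun h => hne j hj.ne (by omega), hdisj k j hk (by omega)⟩
    have v₂ : M' 1 (p' + k * s) = M 1 (p' + k * s) := hr _ fun j hj =>
      ⟨fun h => hdisj j k (by omega) hk h.symm, fun h => hne j hj.ne (by omega)⟩
    have hpp := hdisj k k hk hk
    have e4 : M' 4 0 = N := by rw [hA 4 (by decide), h4]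
    have e9 : M' 9 0 = c₁ := by rw [hA 9 (by decide), h9]
    have e10 : M' 10 0 = c₂ := by rw [hA 10 (by decide), h10]
    have e11 : M' 11 0 = c₃ := by rw [hA 11 (by decide), h11]
    have e12 : M' 12 0 = c₄ := by rw [hA 12 (by decide), h12]
    have e13 : M' 13 0 = p := by rw [hA 13 (by decide), h13]
    have e14 : M' 14 0 = p' := by rw [hA 14 (by decide), h14]
    have e15 : M' 15 0 = s := by rw [hA 15 (by decide), h15]
    refine Runs.assign_seq 0 (M 1 (p + k * s)) hb' ⟨by decide, by decide⟩ rfl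
      (by simp [e13, e15, hk7, v₁]) (hb _ _) fun hb₁ => ?_
    refine Runs.assign_seq (p + k * s) ((c₁ * M 1 (p + k * s) + c₂ * M 1 (p' + k * s)) % N) hb₁
      ⟨by decide, by decide⟩ (by simp [write_apply, e13, e15, hk7])
      (by simp [write_apply, e4, e9, e10, e14, e15, hk7, v₂])
      (natAbs_emod_le hN hNβ _) fun hb₂ => ?_
    refine Runs.assign (iv := p' + k * s)
      (ev := (c₃ * M 1 (p + k * s) + c₄ * M 1 (p' + k * s)) % N) hb₂
      ⟨by decide, by decide⟩ (by simp [write_apply, e14, e15, hk7])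
      (by simp [write_apply, e4, e11, e12, e14, e15, hk7, v₂, hpp.symm])
      (natAbs_emod_le hN hNβ _) fun _ => ?_
    refine ⟨by simp [write_apply, hk7], ?_, ?_, ?_⟩
    · exact (((hA.write (by decide) _ _).write (by decide) _ _).write (by decide) _ _).write
        (by decide) _ _
    · intro j hj
      rcases Nat.lt_succ_iff_lt_or_eq.1 hj with hj | rfl
      · have d₁ := hdisj j k (by omega) hk
        have d₂ := hdisj k j hk (by omega)
        have d₃ := hne j hj.ne
        simp [write_apply, hd j hj, d₁, d₂.symm, d₃]
      · simp [write_apply, hpp]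
    · intro z hz
      have h₁ := hz k (Nat.lt_succ_self k)
      simp only [write_apply, h₁.1, h₁.2]
      simp [hr z fun j hj => hz j (by omega)]

/-- Entry `(i, j)` of the matrix with `d` columns which is stored row by row in array `1`. -/
def entry (d : ℕ) (M : Memory) (i j : ℕ) : ℤ := M 1 ((i : ℤ) * d + j)

theorem address_inj {i i' j j' : ℕ} (hj : j < d) (hj' : j' < d)
    (h : (i : ℤ) * d + j = i' * d + j') : i = i' ∧ j = j' := by
  have h' : i * d + j = i' * d + j' := by exact_mod_cast h
  have h₁ : (i * d + j) / d = i := by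
    rw [Nat.add_comm, Nat.add_mul_div_right _ _ (by omega), Nat.div_eq_of_lt hj, Nat.zero_add]
  have h₂ : (i' * d + j') / d = i' := by
    rw [Nat.add_comm, Nat.add_mul_div_right _ _ (by omega), Nat.div_eq_of_lt hj', Nat.zero_add]
  obtain rfl : i = i' := by rw [← h₁, ← h₂, h']
  exact ⟨rfl, by omega⟩

/-- With stride `1` the lines are rows. -/
theorem runs_line_row (hb : Bdd β M) (hN : 0 < N) (hNβ : N ≤ β) {c₁ c₂ c₃ c₄ : ℤ}
    (hdβ : d ≤ β) (htf : t ≠ f) (h4 : M 4 0 = N) (h9 : M 9 0 = c₁)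
    (h10 : M 10 0 = c₂) (h11 : M 11 0 = c₃) (h12 : M 12 0 = c₄) (h13 : M 13 0 = t * d)
    (h14 : M 14 0 = f * d) (h15 : M 15 0 = 1) (h16 : M 16 0 = d) :
    Runs β line M (5 * d + 2) fun M' => Agree [1, 7, 21] M M' ∧
      ∀ i j, j < d → entry d M' i j = rowOp N c₁ c₂ c₃ c₄ t f (entry d M) i j := by
  refine (runs_line hb hN hNβ hdβ h4 h9 h10 h11 h12 h13 h14 h15 h16 one_pos ?_).mono le_rfl ?_
  · intro k k' hk hk' h
    exact htf (address_inj hk hk' (by simpa using h)).1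
  · rintro M' - ⟨hA, h₁, h₂⟩
    refine ⟨hA, fun i j hj => ?_⟩
    unfold rowOp entry
    split_ifs with hit hif
    · subst hit; simpa using (h₁ j hj).1
    · subst hif; simpa using (h₁ j hj).2
    · refine h₂ _ fun k hk => ⟨fun h => hit ?_, fun h => hif ?_⟩ <;>
        exact (address_inj hj hk (by simpa using h)).1

/-- With stride `d` the lines are columns. -/
theorem runs_line_col (hb : Bdd β M) (hN : 0 < N) (hNβ : N ≤ β) {c₁ c₂ c₃ c₄ : ℤ} {c : ℕ}
    (ht : t < d) (hf : f < d) (hcβ : c ≤ β) (htf : t ≠ f) (h4 : M 4 0 = N) (h9 : M 9 0 = c₁)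
    (h10 : M 10 0 = c₂) (h11 : M 11 0 = c₃) (h12 : M 12 0 = c₄) (h13 : M 13 0 = t)
    (h14 : M 14 0 = f) (h15 : M 15 0 = d) (h16 : M 16 0 = c) :
    Runs β line M (5 * c + 2) fun M' => Agree [1, 7, 21] M M' ∧
      ∀ i j, i < c → j < d → entry d M' i j = colOp N c₁ c₂ c₃ c₄ t f (entry d M) i j := by
  refine (runs_line hb hN hNβ hcβ h4 h9 h10 h11 h12 h13 h14 h15 h16 (by omega) ?_).mono le_rfl ?_
  · intro k k' hk hk' h
    exact htf (address_inj (i := k) (i' := k') ht hf (by linarith)).2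
  · rintro M' - ⟨hA, h₁, h₂⟩
    refine ⟨hA, fun i j hi hj => ?_⟩
    unfold colOp entry
    simp only [fun x : ℕ => Int.add_comm ((i : ℤ) * d) x]
    split_ifs with hit hif
    · subst hit; exact (h₁ i hi).1
    · subst hif; exact (h₁ i hi).2
    · refine h₂ _ fun k hk => ⟨fun h => hit ?_, fun h => hif ?_⟩
      · exact (address_inj (i := i) (i' := k) hj ht (by linarith)).2
      · exact (address_inj (i := i) (i' := k) hj hf (by linarith)).2

/-- Set the variables `a`, …, `a + 3`. -/
def setFour (a : ℕ) (e₁ e₂ e₃ e₄ : Expr) : Prog :=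
  .seq (.assign a 0 e₁)
    (.seq (.assign (a + 1) 0 e₂) (.seq (.assign (a + 2) 0 e₃) (.assign (a + 3) 0 e₄)))

/-- Divide the entry in the second line by the pivot in the first line, both at position `t`
(variable `6`), and set the coefficients of the reduction step. A pivot `0` is replaced by `N`, which has the same residue. -/
def chooseCoeffs : Prog :=
  .seq (.assign 24 0 (.cell 1 (var 13 + var 6 * var 15)))
  (.seq (.assign 25 0 (.cell 1 (var 14 + var 6 * var 15)))
  (.seq (.cond (var 24) .skip (.assign 24 0 (var 4)))
  (.seq (.assign 18 0 ((2 * var 25 + var 24) / (2 * var 24)))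
  (.seq (.assign 19 0 (var 25 - var 18 * var 24))
  (.cond (var 19) (setFour 9 (0 - var 18) 1 1 0)
    (.cond (0 - var 19) (setFour 9 (var 18) (0 - 1) 1 0) (setFour 9 1 0 (0 - var 18) 1)))))))

theorem runs_setFour (a : ℕ) (hb : Bdd β M) {e₁ e₂ e₃ e₄ : Expr} {c₁ c₂ c₃ c₄ : ℤ}
    (hw : e₁.wt ≤ 40 ∧ e₂.wt ≤ 40 ∧ e₃.wt ≤ 40 ∧ e₄.wt ≤ 40)
    (he : ∀ M', Agree [a, a + 1, a + 2, a + 3] M M' →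
      e₁.eval M' = c₁ ∧ e₂.eval M' = c₂ ∧ e₃.eval M' = c₃ ∧ e₄.eval M' = c₄)
    (hc : c₁.natAbs ≤ β ∧ c₂.natAbs ≤ β ∧ c₃.natAbs ≤ β ∧ c₄.natAbs ≤ β) :
    Runs β (setFour a e₁ e₂ e₃ e₄) M 4 fun M' => Agree [a, a + 1, a + 2, a + 3] M M' ∧
      M' a 0 = c₁ ∧ M' (a + 1) 0 = c₂ ∧ M' (a + 2) 0 = c₃ ∧ M' (a + 3) 0 = c₄ := by
  have A₁ : Agree [a, a + 1, a + 2, a + 3] M (M.write a 0 c₁) :=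
    (Agree.refl _ M).write (by simp) _ _
  have A₂ := A₁.write (a := a + 1) (by simp) 0 c₂
  have A₃ := A₂.write (a := a + 2) (by simp) 0 c₃
  have A₄ := A₃.write (a := a + 3) (by simp) 0 c₄
  refine Runs.assign_seq 0 c₁ hb ⟨by decide, hw.1⟩ rfl (he _ (Agree.refl _ _)).1 hc.1
    fun hb₁ => ?_
  refine Runs.assign_seq 0 c₂ hb₁ ⟨by decide, hw.2.1⟩ rfl (he _ A₁).2.1 hc.2.1 fun hb₂ => ?_
  refine Runs.assign_seq 0 c₃ hb₂ ⟨by decide, hw.2.2.1⟩ rfl (he _ A₂).2.2.1 hc.2.2.1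
    fun hb₃ => ?_
  refine Runs.assign hb₃ ⟨by decide, hw.2.2.2⟩ (iv := 0) rfl (he _ A₃).2.2.2 hc.2.2.2 fun _ => ?_
  exact ⟨A₄, by simp [write_apply], by simp [write_apply], by simp [write_apply], by simp⟩

theorem runs_chooseCoeffs (hb : Bdd β M) (hN : 0 < N) (hNβ : N ≤ β) {p p' s x y : ℤ}
    (h4 : M 4 0 = N) (h6 : M 6 0 = t) (h13 : M 13 0 = p) (h14 : M 14 0 = p') (h15 : M 15 0 = s)
    (hx : M 1 (p + t * s) = x) (hy : M 1 (p' + t * s) = y) (hx0 : 0 ≤ x) (hxN : x < N)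
    (hy0 : 0 < y) (hyN : y < N) :
    Runs β chooseCoeffs M 12 fun M' => Agree [9, 10, 11, 12, 18, 19, 24, 25] M M' ∧
      Reduces N x y (M' 9 0) (M' 10 0) (M' 11 0) (M' 12 0) := by
  set a : ℤ := if 0 < x then x else N with ha
  set q : ℤ := (2 * y + a) / (2 * a) with hq
  set r : ℤ := y - q * a with hr
  obtain ⟨k₁, k₂, k₃, ha0, haN, hr₁, hr₂⟩ :=
    reduces_of_balanced hN hx0 hxN ha hq hr
  have hq0 : 0 ≤ q := Int.ediv_nonneg (by omega) (by omega)
  have hqy : q ≤ y := by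
    by_contra h
    have h₁ : (y + 1) * a ≤ q * a := mul_le_mul_of_nonneg_right (by omega) ha0.le
    nlinarith
  have hA : Agree [9, 10, 11, 12, 18, 19, 24, 25] M M := Agree.refl _ _
  refine Runs.assign_seq (n := 11) 0 x hb ⟨by decide, by decide⟩ rfl
    (by simp [h13, h6, h15, hx]) (by omega) fun hb₁ => ?_
  refine Runs.assign_seq (n := 10) 0 y hb₁ ⟨by decide, by decide⟩ rfl
    (by simp [write_apply, h14, h6, h15, hy]) (by omega) fun hb₂ => ?_
  refine Runs.seq (n := 2) (n' := 8) (Q := fun M' => M' 24 0 = a ∧ M' 25 0 = y ∧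
    Agree [9, 10, 11, 12, 18, 19, 24, 25] M M') ?_ ?_
  · refine Runs.cond hb₂ (by decide) (fun h => ?_) (fun h => ?_)
    · simp only [eval_cell, eval_zero, write_apply] at h
      norm_num at h
      refine Runs.skip hb₂ ⟨?_, by simp, (hA.write (by decide) _ _).write (by decide) _ _⟩
      simp [write_apply, ha, h]
    · simp only [eval_cell, eval_zero, write_apply] at h
      norm_num at h
      have hax : a = N := by rw [ha, if_neg (by omega)]
      refine Runs.assign hb₂ ⟨by decide, by decide⟩ rfl (ev := N) (by simp [write_apply, h4])
        (by omega) fun _ => ⟨?_, ?_, ?_⟩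
      · simp [hax]
      · simp [write_apply]
      · exact ((hA.write (by decide) _ _).write (by decide) _ _).write (by decide) _ _
  rintro M₁ hb₃ ⟨e24, e25, hA₁⟩
  refine Runs.assign_seq (n := 7) 0 q hb₃ ⟨by decide, by decide⟩ rfl
    (by simp [e24, e25, hq]) (by omega) fun hb₄ => ?_
  refine Runs.assign_seq (n := 6) 0 r hb₄ ⟨by decide, by decide⟩ rfl
    (by rw [hr]; simp [write_apply, e24, e25]) (by omega) fun hb₅ => ?_
  have e18 : ∀ M', Agree [9, 10, 11, 12] ((M₁.write 18 0 q).write 19 0 r) M' → M' 18 0 = q :=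
    fun M' h => by rw [h 18 (by decide)]; simp [write_apply]
  have hfin : ∀ M', Agree [9, 10, 11, 12] ((M₁.write 18 0 q).write 19 0 r) M' →
      Agree [9, 10, 11, 12, 18, 19, 24, 25] M M' := fun M' h =>
    ((hA₁.write (by decide) _ _).write (by decide) _ _).trans (h.mono (by decide))
  refine Runs.cond hb₅ (by decide) (fun h => ?_) (fun h => ?_)
  · have hr0 : 0 < r := by simpa [write_apply] using h
    refine (runs_setFour 9 (c₁ := -q) (c₂ := 1) (c₃ := 1) (c₄ := 0) hb₅
      ⟨by decide, by decide, by decide, by decide⟩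
      (fun M' h => by simp [e18 M' h]) (by omega)).mono (by norm_num) ?_
    rintro M' - ⟨h₀, h₁, h₂, h₃, h₄⟩
    rw [h₁, h₂, h₃, h₄]
    exact ⟨hfin M' h₀, k₁ hr0⟩
  · have hr0 : r ≤ 0 := by simpa [write_apply] using h
    refine Runs.cond hb₅ (by decide) (fun h => ?_) (fun h => ?_)
    · have hr0 : r < 0 := by simpa [write_apply] using h
      refine (runs_setFour 9 (c₁ := q) (c₂ := -1) (c₃ := 1) (c₄ := 0) hb₅
        ⟨by decide, by decide, by decide, by decide⟩
        (fun M' h => by simp [e18 M' h]) (by omega)).mono (by norm_num) ?_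
      rintro M' - ⟨h₀, h₁, h₂, h₃, h₄⟩
      rw [h₁, h₂, h₃, h₄]
      exact ⟨hfin M' h₀, k₂ hr0⟩
    · have hr1 : 0 ≤ r := by simpa [write_apply] using h
      refine (runs_setFour 9 (c₁ := 1) (c₂ := 0) (c₃ := -q) (c₄ := 1) hb₅
        ⟨by decide, by decide, by decide, by decide⟩
        (fun M' h => by simp [e18 M' h]) (by omega)).mono (by norm_num) ?_
      rintro M' - ⟨h₀, h₁, h₂, h₃, h₄⟩
      rw [h₁, h₂, h₃, h₄]
      exact ⟨hfin M' h₀, k₃ (by omega)⟩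

/-- Look for a positive entry of array `1` at the addresses `b + i * s`, `t < i < l`, and store the
index of the last one in variable `8`, or `0` if there is none. -/
def search (l b s : Expr) : Prog :=
  .seq (.assign 8 0 0)
    (.forUpTo 17 (var 6 + 1) l (.cond (.cell 1 (b + var 17 * s)) (.assign 8 0 (var 17)) .skip))

theorem runs_search (hb : Bdd β M) {l b s : Expr} {lv : ℕ} {bv sv : ℤ}
    (hw : l.wt ≤ 10 ∧ b.wt ≤ 10 ∧ s.wt ≤ 10) (hl : lv ≤ β) (h6 : M 6 0 = t) (htl : t < lv)
    (he : ∀ M', Agree [8, 17] M M' → l.eval M' = lv ∧ b.eval M' = bv ∧ s.eval M' = sv) :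
    Runs β (search l b s) M (4 * lv + 3) fun M' => Agree [8, 17] M M' ∧
      ((M' 8 0 = 0 ∧ ∀ i : ℕ, t < i → i < lv → M 1 (bv + i * sv) ≤ 0) ∨
        ∃ f : ℕ, M' 8 0 = f ∧ t < f ∧ f < lv ∧ 0 < M 1 (bv + f * sv)) := by
  refine Runs.assign_seq (n := 4 * lv + 2) 0 0 hb ⟨by decide, by decide⟩ rfl rfl (by simp)
    fun hb₁ => ?_
  refine (Runs.forUpTo (n := 2) (t + 1) lv (fun k M' => Agree [8, 17] M M' ∧
      ((M' 8 0 = 0 ∧ ∀ i : ℕ, t < i → i < k → M 1 (bv + i * sv) ≤ 0) ∨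
        ∃ f : ℕ, M' 8 0 = f ∧ t < f ∧ f < k ∧ 0 < M 1 (bv + f * sv))) hb₁
    ⟨by decide, by omega⟩ (by simp [write_apply, h6]) htl hl ?_ ?_ ?_).mono le_rfl
    fun M' _ h => h.2
  · refine ⟨((Agree.refl _ M).write (by decide) _ _).write (by decide) _ _,
      Or.inl ⟨by simp [write_apply], by omega⟩⟩
  · exact fun k M' h => (he M' h.1).1
  · rintro k M' hb' hk hkl h17 ⟨hA, h⟩
    obtain ⟨-, e₂, e₃⟩ := he M' hA
    have hcell : (Expr.cell 1 (b + var 17 * s)).eval M' = M 1 (bv + k * sv) := by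
      simp [e₂, e₃, h17, hA 1 (by decide)]
    refine Runs.cond hb' ?_ (fun hpos => ?_) (fun hpos => ?_)
    · have : (Expr.cell 1 (b + var 17 * s)).wt = b.wt + (2 + s.wt + 1) + 1 + 1 := rfl
      omega
    · rw [hcell] at hpos
      refine Runs.assign hb' ⟨by decide, by decide⟩ rfl (ev := k) (by simp [h17]) (by omega)
        fun _ => ⟨by simp [write_apply, h17], ?_, Or.inr ⟨k, ?_, by omega, by omega, hpos⟩⟩
      · exact (hA.write (by decide) _ _).write (by decide) _ _
      · simp [write_apply]
    · rw [hcell] at hpos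
      refine Runs.skip hb' ⟨h17, hA.write (by decide) _ _, ?_⟩
      rw [write_of_ne _ _ _ (by decide)]
      rcases h with ⟨h₁, h₂⟩ | ⟨f, h₁, h₂, h₃, h₄⟩
      · refine Or.inl ⟨h₁, fun i hi hik => ?_⟩
        rcases Nat.lt_succ_iff_lt_or_eq.1 hik with h | rfl
        exacts [h₂ i hi h, hpos]
      · exact Or.inr ⟨f, h₁, h₂, by omega, h₄⟩

end NullGen

/-! ### Diagonalisation and its running time -/

namespace NullGen

open RAM Diagonalization

/-- The dimensions and the modulus, as the elimination finds them in memory. -/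
structure Env (m d N : ℕ) (M : Memory) : Prop where
  rows : M 0 0 = m
  cols : M 0 1 = d
  modulus : M 4 0 = N
  height : M 5 0 = (m + d : ℕ)

theorem Env.agree {m d N : ℕ} {M M' : Memory} {S : List ℕ} (h : Env m d N M) (hA : Agree S M M')
    (hS : 0 ∉ S ∧ 4 ∉ S ∧ 5 ∉ S) : Env m d N M' :=
  ⟨by rw [hA 0 hS.1, h.rows], by rw [hA 0 hS.1, h.cols], by rw [hA 4 hS.2.1, h.modulus],
    by rw [hA 5 hS.2.2, h.height]⟩

/-- The bound `β` on the contents of the memory leaves room for residues modulo `N` and for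
the addresses of the matrix. -/
structure Sizes (β m d N : ℕ) : Prop where
  pos : 0 < N
  modulus_le : N ≤ β
  dims_le : (m + d + d + 1) * (d + 1) ≤ β

theorem Sizes.height_le {β m d N : ℕ} (h : Sizes β m d N) : m + d + d + 1 ≤ β :=
  (Nat.le_mul_of_pos_right _ (Nat.succ_pos d)).trans h.dims_le

theorem Sizes.mul_le {β m d N i : ℕ} (h : Sizes β m d N) (hi : i ≤ m + d + d) : i * d ≤ β :=
  (Nat.mul_le_mul (by omega) (Nat.le_succ d)).trans h.dims_le

/-- The arrays changed by the elimination. -/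
abbrev scratch : List ℕ := [1, 7, 8, 9, 10, 11, 12, 13, 14, 15, 16, 17, 18, 19, 20, 21, 24, 25]

/-- Reduce the pivot in row and column `t` by the entry in row `f` (variable `8`) below it. -/
def rowStep : Prog :=
  .seq (setFour 13 (var 6 * .cell 0 1) (var 8 * .cell 0 1) 1 (.cell 0 1)) (.seq chooseCoeffs line)

/-- Reduce the pivot in row and column `t` by the entry in column `f` to the right of it. -/
def colStep : Prog :=
  .seq (setFour 13 (var 6) (var 8) (.cell 0 1) (var 5 + .cell 0 1)) (.seq chooseCoeffs line)

variable {β m d N t f : ℕ} {M : Memory} {K : AddSubgroup (Fin d → ZMod N)}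

theorem runs_rowStep (hb : Bdd β M) (hE : Env m d N M) (hβ : Sizes β m d N)
    (hI : Inv N (m + d) d K (entry d M)) (hD : Diag (m + d) d t (entry d M)) (h6 : M 6 0 = t)
    (h8 : M 8 0 = f) (ht : t < d) (htf : t < f) (hf : f < m + d) (hpos : 0 < entry d M f t) :
    Runs β rowStep M (5 * d + 18) fun M' => Agree scratch M M' ∧
      Inv N (m + d) d K (entry d M') ∧ Diag (m + d) d t (entry d M') ∧
      potential N (m + d) d t (entry d M') < potential N (m + d) d t (entry d M) := by
  have hN := hβ.pos
  have hdim := hβ.height_le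
  have b₁ := hβ.mul_le (i := t) (by omega)
  have b₂ := hβ.mul_le (i := f) (by omega)
  have key : Runs β rowStep M (4 + (12 + (5 * d + 2))) fun M' => Agree scratch M M' ∧
      ∃ c₁ c₂ c₃ c₄, Reduces N (entry d M t t) (entry d M f t) c₁ c₂ c₃ c₄ ∧
        ∀ i j, j < d → entry d M' i j = rowOp N c₁ c₂ c₃ c₄ t f (entry d M) i j := by
    refine Runs.seq (runs_setFour 13 (c₁ := (t * d : ℕ)) (c₂ := (f * d : ℕ)) (c₃ := 1) (c₄ := d) hb
      ⟨by decide, by decide, by decide, by decide⟩ (fun M' h => ?_) (by omega)) ?_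
    · simp [h 6 (by decide), h 8 (by decide), h 0 (by decide), h6, h8, hE.cols]
    rintro M₁ hb₁ ⟨hA₁, h13, h14, h15, h16⟩
    have hE₁ := hE.agree hA₁ (by decide)
    have hM₁ : M₁ 1 = M 1 := hA₁ 1 (by decide)
    refine Runs.seq (runs_chooseCoeffs (t := t) hb₁ hN hβ.modulus_le hE₁.modulus
      (by rw [hA₁ 6 (by decide), h6]) h13 h14 h15 (x := entry d M t t) (y := entry d M f t)
      (by rw [hM₁]; simp [entry]) (by rw [hM₁]; simp [entry])
      (hI.nonneg t t (by omega) ht) (hI.lt t t (by omega) ht) hpos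
      (hI.lt f t (by omega) ht)) ?_
    rintro M₂ hb₂ ⟨hA₂, hred⟩
    refine (runs_line_row (t := t) (f := f) hb₂ hN hβ.modulus_le (by omega) htf.ne
      (hE₁.agree hA₂ (by decide)).modulus rfl rfl rfl rfl
      (by rw [hA₂ 13 (by decide), h13]; push_cast; rfl)
      (by rw [hA₂ 14 (by decide)]; exact h14.trans (by push_cast; rfl))
      (by rw [hA₂ 15 (by decide)]; exact h15)
      (by rw [hA₂ 16 (by decide)]; exact h16)).mono le_rfl ?_
    rintro M₃ - ⟨hA₃, h₃⟩
    refine ⟨((hA₁.mono (by decide)).trans (hA₂.mono (by decide))).trans (hA₃.mono (by decide)),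
      _, _, _, _, hred, fun i j hj => ?_⟩
    have : entry d M₂ = entry d M := by
      unfold entry; rw [hA₂ 1 (by decide), hM₁]
    rw [h₃ i j hj, this]
  refine key.mono (by omega) ?_
  rintro M' - ⟨hA, c₁, c₂, c₃, c₄, hred, h⟩
  obtain ⟨e, he₁, he₂⟩ := hred.1
  refine ⟨hA, (hI.rowOp hN (by omega) hf htf.ne he₁ he₂).congr fun i j _ hj => h i j hj,
    (hD.rowOp hf htf).congr fun i j _ hj => h i j hj, ?_⟩
  rw [potential_congr (by omega) ht fun i j _ hj => h i j hj]
  exact potential_rowOp hred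
    (fun j hj => ⟨hI.nonneg t j (by omega) hj, hI.lt t j (by omega) hj⟩) ht hf htf hpos.ne'

theorem runs_colStep (hb : Bdd β M) (hE : Env m d N M) (hβ : Sizes β m d N)
    (hI : Inv N (m + d) d K (entry d M)) (hD : Diag (m + d) d t (entry d M)) (h6 : M 6 0 = t)
    (h8 : M 8 0 = f) (ht : t < d) (htf : t < f) (hf : f < d) (hpos : 0 < entry d M t f) :
    Runs β colStep M (5 * (m + d + d) + 18) fun M' => Agree scratch M M' ∧
      Inv N (m + d) d K (entry d M') ∧ Diag (m + d) d t (entry d M') ∧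
      potential N (m + d) d t (entry d M') < potential N (m + d) d t (entry d M) := by
  have hN := hβ.pos
  have hdim := hβ.height_le
  have key : Runs β colStep M (4 + (12 + (5 * (m + d + d) + 2))) fun M' => Agree scratch M M' ∧
      ∃ c₁ c₂ c₃ c₄, Reduces N (entry d M t t) (entry d M t f) c₁ c₂ c₃ c₄ ∧
        ∀ i j, i < m + d + d → j < d →
          entry d M' i j = colOp N c₁ c₂ c₃ c₄ t f (entry d M) i j := by
    refine Runs.seq (runs_setFour 13 (c₁ := t) (c₂ := f) (c₃ := d) (c₄ := (m + d + d : ℕ)) hb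
      ⟨by decide, by decide, by decide, by decide⟩ (fun M' h => ?_) (by omega)) ?_
    · simp [h 6 (by decide), h 8 (by decide), h 0 (by decide), h 5 (by decide), h6, h8, hE.cols,
        hE.height]
    rintro M₁ hb₁ ⟨hA₁, h13, h14, h15, h16⟩
    have hE₁ := hE.agree hA₁ (by decide)
    have hM₁ : M₁ 1 = M 1 := hA₁ 1 (by decide)
    refine Runs.seq (runs_chooseCoeffs (t := t) hb₁ hN hβ.modulus_le hE₁.modulus
      (by rw [hA₁ 6 (by decide), h6]) h13 h14 h15 (x := entry d M t t) (y := entry d M t f)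
      (by rw [hM₁, Int.add_comm]; simp [entry]) (by rw [hM₁, Int.add_comm]; simp [entry])
      (hI.nonneg t t (by omega) ht) (hI.lt t t (by omega) ht) hpos
      (hI.lt t f (by omega) hf)) ?_
    rintro M₂ hb₂ ⟨hA₂, hred⟩
    refine (runs_line_col (t := t) (f := f) hb₂ hN hβ.modulus_le ht hf (by omega) htf.ne
      (hE₁.agree hA₂ (by decide)).modulus rfl rfl rfl rfl
      (by rw [hA₂ 13 (by decide), h13])
      (by rw [hA₂ 14 (by decide)]; exact h14)
      (by rw [hA₂ 15 (by decide)]; exact h15)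
      (by rw [hA₂ 16 (by decide)]; exact h16)).mono le_rfl ?_
    rintro M₃ - ⟨hA₃, h₃⟩
    refine ⟨((hA₁.mono (by decide)).trans (hA₂.mono (by decide))).trans (hA₃.mono (by decide)),
      _, _, _, _, hred, fun i j hi hj => ?_⟩
    have : entry d M₂ = entry d M := by
      unfold entry; rw [hA₂ 1 (by decide), hM₁]
    rw [h₃ i j hi hj, this]
  refine key.mono (by omega) ?_
  rintro M' - ⟨hA, c₁, c₂, c₃, c₄, hred, h⟩
  obtain ⟨e, he₁, he₂⟩ := hred.1
  refine ⟨hA, (hI.colOp hN ht hf htf.ne he₁ he₂).congr h,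
    (hD.colOp hf htf).congr fun i j hi hj => h i j (by omega) hj, ?_⟩
  rw [potential_congr (by omega) ht fun i j hi hj => h i j (by omega) hj]
  exact potential_colOp hred
    (fun i hi => ⟨hI.nonneg i t (by omega) ht, hI.lt i t (by omega) ht⟩) (by omega) hf htf hpos.ne'

/-- Reduce the pivot by a nonzero entry of its column or else of its row, and record in
variable `20` whether there was one. -/
def round : Prog :=
  .seq (.assign 20 0 0)
  (.seq (search (var 5) (var 6) (.cell 0 1))
  (.cond (var 8) (.seq rowStep (.assign 20 0 1))
  (.seq (search (.cell 0 1) (var 6 * .cell 0 1) 1)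
  (.cond (var 8) (.seq colStep (.assign 20 0 1)) .skip))))

theorem runs_round (hb : Bdd β M) (hE : Env m d N M) (hβ : Sizes β m d N)
    (hI : Inv N (m + d) d K (entry d M)) (hD : Diag (m + d) d t (entry d M)) (h6 : M 6 0 = t)
    (ht : t < d) :
    Runs β round M (14 * (m + d + d) + 40) fun M' => Agree scratch M M' ∧
      Inv N (m + d) d K (entry d M') ∧ Diag (m + d) d t (entry d M') ∧
      ((M' 20 0 = 1 ∧
        potential N (m + d) d t (entry d M') < potential N (m + d) d t (entry d M)) ∨
      (M' 20 0 = 0 ∧ Diag (m + d) d (t + 1) (entry d M') ∧ entry d M' = entry d M)) := by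
  have hdim := hβ.height_le
  have S₀ : Agree scratch M (M.write 20 0 0) := (Agree.refl _ M).write (by decide) _ _
  refine (Runs.assign_seq (n := (4 * (m + d) + 3) + ((4 * d + 3 + (5 * (m + d + d) + 20)) + 1)) 0 0
    hb ⟨by decide, by decide⟩ rfl rfl (by omega) fun hb₁ => ?_).mono (by omega) fun _ _ h => h
  refine Runs.seq (runs_search (t := t) (lv := m + d) (bv := t) (sv := d) hb₁
    ⟨by decide, by decide, by decide⟩ (by omega) (by simp [write_apply, h6]) (by omega)
    fun M' h => ?_) ?_
  · simp [h 5 (by decide), h 6 (by decide), h 0 (by decide), write_apply, h6, hE.cols, hE.height]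
  rintro M₁ hb₁ ⟨hA₁, h₁⟩
  have S₁ : Agree scratch M M₁ := S₀.trans (hA₁.mono (by decide))
  have w₁ : M₁ 1 = M 1 := by rw [hA₁ 1 (by decide)]; exact write_of_ne _ _ _ (by decide)
  have hE₁ := hE.agree S₁ (by decide)
  have e₁ : entry d M₁ = entry d M := by unfold entry; rw [w₁]
  have h6₁ : M₁ 6 0 = t := by rw [S₁ 6 (by decide), h6]
  -- The common end of both branches that perform a step.
  have flag : ∀ {M₁ : Memory} {p : Prog} {c : ℕ}, Agree scratch M M₁ →
      Runs β p M₁ c (fun M' => Agree scratch M₁ M' ∧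
        Inv N (m + d) d K (entry d M') ∧ Diag (m + d) d t (entry d M') ∧
        potential N (m + d) d t (entry d M') < potential N (m + d) d t (entry d M)) →
      Runs β (.seq p (.assign 20 0 1)) M₁ (c + 1) fun M' => Agree scratch M M' ∧
        Inv N (m + d) d K (entry d M') ∧ Diag (m + d) d t (entry d M') ∧
        ((M' 20 0 = 1 ∧
          potential N (m + d) d t (entry d M') < potential N (m + d) d t (entry d M)) ∨
        (M' 20 0 = 0 ∧ Diag (m + d) d (t + 1) (entry d M') ∧ entry d M' = entry d M)) := by
    intro M₁ p c hA hp
    refine hp.seq fun M' hb' ⟨h₁, h₂, h₃, h₄⟩ => ?_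
    refine Runs.assign hb' ⟨by decide, by decide⟩ (iv := 0) (ev := 1) rfl rfl (by omega) fun _ => ?_
    have : entry d (M'.write 20 0 1) = entry d M' := by
      unfold entry; rw [write_of_ne _ _ _ (by decide)]
    rw [this]
    exact ⟨(hA.trans h₁).write (by decide) _ _, h₂, h₃, Or.inl ⟨write_same _ _ _ _, h₄⟩⟩
  rw [write_of_ne _ _ _ (by decide : (1 : ℕ) ≠ 20)] at h₁
  refine Runs.cond hb₁ (by decide) (fun hpos => ?_) (fun hpos => ?_)
  · rcases h₁ with ⟨h, -⟩ | ⟨f, h8, htf, hf, hft⟩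
    · simp [h] at hpos
    refine (flag S₁ ((runs_rowStep (t := t) (f := f) (K := K) hb₁ hE₁ hβ (by rwa [e₁])
      (by rwa [e₁]) h6₁ h8 ht htf hf ?_).mono le_rfl ?_)).mono (by omega) fun _ _ h => h
    · rw [e₁]; unfold entry; rwa [Int.add_comm]
    · intro M' _ h
      rwa [e₁] at h
  rcases h₁ with ⟨h8, hcol⟩ | ⟨f, h8, htf, hf, hft⟩
  swap
  · simp [h8] at hpos; omega
  have hcol' : ∀ i, t < i → i < m + d → entry d M i t = 0 := fun i h₁ h₂ =>
    le_antisymm (by unfold entry; rw [Int.add_comm]; exact hcol i h₁ h₂)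
      (hI.nonneg i t (by omega) ht)
  have b₁ := hβ.mul_le (i := t) (by omega)
  refine Runs.seq (runs_search (t := t) (lv := d) (bv := (t * d : ℕ)) (sv := 1) hb₁
    ⟨by decide, by decide, by decide⟩ (by omega) h6₁ ht fun M' h => ?_) ?_
  · simp [h 6 (by decide), h 0 (by decide), h6₁, hE₁.cols]
  rintro M₂ hb₂ ⟨hA₂, h₂⟩
  have S₂ : Agree scratch M M₂ := S₁.trans (hA₂.mono (by decide))
  have w₂ : M₂ 1 = M 1 := by rw [hA₂ 1 (by decide), w₁]
  have hE₂ := hE.agree S₂ (by decide)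
  have e₂ : entry d M₂ = entry d M := by unfold entry; rw [w₂]
  have h6₂ : M₂ 6 0 = t := by rw [S₂ 6 (by decide), h6]
  rw [w₁] at h₂
  refine Runs.cond (n := 5 * (m + d + d) + 19) hb₂ (by decide) (fun hpos => ?_) (fun hpos => ?_)
  · rcases h₂ with ⟨h, -⟩ | ⟨f, h8, htf, hf, hft⟩
    · simp [h] at hpos
    refine (flag S₂ ((runs_colStep (t := t) (f := f) (K := K) hb₂ hE₂ hβ (by rwa [e₂])
      (by rwa [e₂]) h6₂ h8 ht htf hf ?_).mono le_rfl ?_)).mono (by omega) fun _ _ h => h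
    · rw [e₂]; unfold entry; simpa using hft
    · intro M' _ h
      rwa [e₂] at h
  · rcases h₂ with ⟨h8, hrow⟩ | ⟨f, h8, htf, hf, hft⟩
    swap
    · simp [h8] at hpos; omega
    have hrow' : ∀ j, t < j → j < d → entry d M t j = 0 := fun j h₁ h₂ =>
      le_antisymm (by simpa [entry] using hrow j h₁ h₂) (hI.nonneg t j (by omega) h₂)
    refine (Runs.skip hb₂ ⟨S₂, e₂ ▸ hI, e₂ ▸ hD, Or.inr ⟨?_, ?_, e₂⟩⟩).mono (by omega)
      fun _ _ h => h
    · rw [hA₂ 20 (by decide), hA₁ 20 (by decide), write_same]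
    · rw [e₂]
      intro i j hi hj hne hor
      by_cases hlt : i < t ∨ j < t
      · exact hD i j hi hj hne hlt
      rcases hor with h | h
      · obtain rfl : i = t := by omega
        exact hrow' j (by omega) hj
      · obtain rfl : j = t := by omega
        exact hcol' i (by omega) hi

/-- Repeat `round` until it finds nothing; this clears the row and the column of the pivot at position `t`. -/
def phase : Prog := .seq (.assign 20 0 1) (.loop (var 20) round)

/-- The potential plus the flag is a variant of the loop: a round which finds no entry only clears
the flag. -/
theorem runs_phase (hb : Bdd β M) (hE : Env m d N M) (hβ : Sizes β m d N)
    (hI : Inv N (m + d) d K (entry d M)) (hD : Diag (m + d) d t (entry d M)) (h6 : M 6 0 = t)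
    (ht : t < d) :
    Runs β phase M ((14 * (m + d + d) + 40 + 1) * ((m + d + d + 1) * (N.size + 1) + 1) + 2)
      fun M' => Agree scratch M M' ∧ Inv N (m + d) d K (entry d M') ∧
        Diag (m + d) d (t + 1) (entry d M') := by
  have hdim := hβ.height_le
  have hw : entry d (M.write 20 0 1) = entry d M := by
    unfold entry; rw [write_of_ne _ _ _ (by decide)]
  refine Runs.assign_seq 0 1 hb ⟨by decide, by decide⟩ rfl rfl (by omega) fun hb₁ => ?_
  refine (Runs.loop (n := 14 * (m + d + d) + 40) (fun M' => Agree scratch M M' ∧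
      Inv N (m + d) d K (entry d M') ∧ Diag (m + d) d t (entry d M') ∧
      (M' 20 0 = 1 ∨ M' 20 0 = 0 ∧ Diag (m + d) d (t + 1) (entry d M')))
    (fun M' => potential N (m + d) d t (entry d M') + (M' 20 0).toNat) hb₁ (by decide)
    ⟨(Agree.refl _ M).write (by decide) _ _, by rwa [hw], by rwa [hw],
      Or.inl (write_same _ _ _ _)⟩ ?_).mono ?_ ?_
  · rintro M₁ hb₁ ⟨hA, hI₁, hD₁, hflag⟩ hpos
    have h20 : M₁ 20 0 = 1 := by
      rcases hflag with h | ⟨h, -⟩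
      · exact h
      · simp [h] at hpos
    refine (runs_round (t := t) hb₁ (hE.agree hA (by decide)) hβ hI₁ hD₁
      (by rw [hA 6 (by decide), h6]) ht).mono le_rfl ?_
    rintro M₂ - ⟨hA₂, hI₂, hD₂, ⟨h, hlt⟩ | ⟨h, hD', he⟩⟩
    · exact ⟨⟨hA.trans hA₂, hI₂, hD₂, Or.inl h⟩, by rw [h, h20]; omega⟩
    · exact ⟨⟨hA.trans hA₂, hI₂, hD₂, Or.inr ⟨h, hD'⟩⟩, by rw [h, h20, he]; simp⟩
  · have h₁ := potential_le (N := N) (n := m + d) (d := d) (t := t) (W := entry d M)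
      (hI.nonneg t t (by omega) ht) (hI.lt t t (by omega) ht)
    rw [hw, write_same]
    have := Nat.mul_le_mul_left (14 * (m + d + d) + 40 + 1) (Nat.add_le_add_right h₁ 1)
    simp only [Int.toNat_one]
    omega
  · rintro M' - ⟨⟨hA, hI', hD', hflag⟩, hpos⟩
    rcases hflag with h | ⟨h, hD''⟩
    · simp [h] at hpos
    · exact ⟨hA, hI', hD''⟩

/-- Bring the matrix to diagonal form. -/
def diagonalize : Prog := .forUpTo 6 0 (.cell 0 1) phase

theorem runs_diagonalize (hb : Bdd β M) (hE : Env m d N M) (hβ : Sizes β m d N)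
    (hI : Inv N (m + d) d K (entry d M)) :
    Runs β diagonalize M
      (((14 * (m + d + d) + 40 + 1) * ((m + d + d + 1) * (N.size + 1) + 1) + 4) * d + 2)
      fun M' => Agree (6 :: scratch) M M' ∧ Inv N (m + d) d K (entry d M') ∧
        Diag (m + d) d d (entry d M') := by
  have hdim := hβ.height_le
  have hw : ∀ (M : Memory) z, entry d (M.write 6 0 z) = entry d M := fun M z => by
    unfold entry; rw [write_of_ne _ _ _ (by decide)]
  refine (Runs.forUpTo 0 d (fun k M' => Agree (6 :: scratch) M M' ∧
      Inv N (m + d) d K (entry d M') ∧ Diag (m + d) d k (entry d M'))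
    hb ⟨by decide, by decide⟩ rfl (Nat.zero_le _) (by omega) ?_ ?_ ?_).mono le_rfl
    fun M' _ h => h.2
  · exact ⟨(Agree.refl _ _).write (by decide) _ _, by rwa [hw],
      fun i j _ _ _ h => by omega⟩
  · rintro k M' ⟨hA, -⟩
    exact (hE.agree hA (by decide)).cols
  · rintro k M' hb' - hk h6 ⟨hA, hI', hD'⟩
    refine (runs_phase hb' (hE.agree hA (by decide)) hβ hI' hD' h6 hk).mono le_rfl ?_
    rintro M'' - ⟨hA'', hI'', hD''⟩
    refine ⟨by rw [hA'' 6 (by decide), h6], ?_, ?_, ?_⟩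
    · exact (hA.trans (hA''.mono (by decide))).write (by decide) _ _
    · rwa [hw]
    · rwa [hw]

end NullGen

/-! ### Preparation of the matrix and output of the generators -/

namespace NullGen

open RAM Diagonalization

/-- For `j < l` (variable `26`), write the value of `v` to the cell of array `a` with address `i`. -/
def fill (a : ℕ) (l i v : Expr) : Prog := .forUpTo 26 0 l (.assign a i v)

variable {β m d N t : ℕ} {M : Memory} {K : AddSubgroup (Fin d → ZMod N)}

theorem runs_fill {a : ℕ} (ha : a ≠ 26) (hb : Bdd β M) {l i v : Expr} {lv : ℕ} {iv ev : ℕ → ℤ}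
    (hw : l.wt ≤ 36 ∧ i.wt ≤ 40 ∧ v.wt ≤ 40) (hl : lv ≤ β)
    (hinj : ∀ j k, j < lv → k < lv → iv j = iv k → j = k)
    (hlim : ∀ M', Agree [a, 26] M M' → l.eval M' = lv)
    (heval : ∀ k M', k < lv → Agree [a, 26] M M' → M' 26 0 = k → M' a (iv k) = M a (iv k) →
      i.eval M' = iv k ∧ v.eval M' = ev k)
    (hev : ∀ k, k < lv → (ev k).natAbs ≤ β) :
    Runs β (fill a l i v) M (3 * lv + 2) fun M' => Agree [a, 26] M M' ∧
      (∀ k, k < lv → M' a (iv k) = ev k) ∧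
      ∀ z, (∀ k, k < lv → z ≠ iv k) → M' a z = M a z := by
  refine (Runs.forUpTo (n := 1) 0 lv (fun k M' => Agree [a, 26] M M' ∧
      (∀ j, j < k → M' a (iv j) = ev j) ∧ ∀ z, (∀ j, j < k → z ≠ iv j) → M' a z = M a z)
    hb ⟨by decide, hw.1⟩ rfl (Nat.zero_le _) hl ?_ ?_ ?_).mono le_rfl fun M' _ h => h.2
  · exact ⟨(Agree.refl _ _).write (by simp) _ _, by simp,
      fun z _ => by rw [write_of_ne _ _ _ ha]⟩
  · exact fun k M' h => hlim M' h.1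
  · rintro k M' hb' - hk h26 ⟨hA, h₁, h₂⟩
    have h₃ := heval k M' hk hA h26 (h₂ _ fun j hj h => hj.ne (hinj _ _ (by omega) hk h.symm))
    refine Runs.assign hb' hw.2 h₃.1 h₃.2 (hev k hk) fun _ => ⟨?_, ?_, ?_, ?_⟩
    · rw [write_of_ne _ _ _ ha.symm, h26]
    · exact (hA.write (by simp) _ _).write (by simp) _ _
    · intro j hj
      rw [write_of_ne _ _ _ ha, write_apply]
      by_cases hjk : j = k
      · simp [hjk]
      · rw [if_neg fun h => hjk (hinj _ _ (by omega) hk h.2), h₁ j (by omega)]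
    · intro z hz
      rw [write_of_ne _ _ _ ha, write_apply, if_neg fun h => hz k (by omega) h.2,
        h₂ z fun j hj => hz j (by omega)]

/-- Multiply row `i` of the matrix by `N / r i`, modulo `N`. -/
def scaleRows : Prog :=
  .forUpTo 17 0 (.cell 0 0) (fill 1 (.cell 0 1) (var 17 * .cell 0 1 + var 26)
    ((.cell 1 (var 17 * .cell 0 1 + var 26) * (var 4 / .cell 2 (var 17))) % var 4))

theorem runs_scaleRows (hb : Bdd β M) (hE : Env m d N M) (hβ : Sizes β m d N) {r : ℕ → ℕ}
    (hr : ∀ i, i < m → M 2 i = r i) :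
    Runs β scaleRows M ((3 * d + 4) * m + 2) fun M' => Agree [1, 17, 26] M M' ∧
      ∀ i j, j < d → entry d M' i j =
        if i < m then (entry d M i j * ((N : ℤ) / r i)) % N else entry d M i j := by
  have hdim := hβ.height_le
  refine (Runs.forUpTo 0 m (fun k M' => Agree [1, 17, 26] M M' ∧
      ∀ i j, j < d → entry d M' i j =
        if i < k then (entry d M i j * ((N : ℤ) / r i)) % N else entry d M i j)
    hb ⟨by decide, by decide⟩ rfl (Nat.zero_le _) (by omega) ?_ ?_ ?_).mono le_rfl
    fun M' _ h => h.2
  · exact ⟨(Agree.refl _ _).write (by decide) _ _, fun i j _ => by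
      simp [entry, write_apply]⟩
  · exact fun k M' h => (hE.agree h.1 (by decide)).rows
  · rintro k M' hb' - hk h17 ⟨hA, h⟩
    have hE' := hE.agree hA (by decide)
    refine (runs_fill (iv := fun j => (k : ℤ) * d + j)
      (ev := fun j => (entry d M' k j * ((N : ℤ) / r k)) % N) (by decide) hb'
      ⟨by decide, by decide, by decide⟩ (by omega : d ≤ β) (fun j j' _ _ h => by simpa using h)
      (fun M'' hA' => by simp [hA' 0 (by decide), hE'.cols]) ?_
      fun j _ => natAbs_emod_le hβ.pos hβ.modulus_le _).mono le_rfl ?_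
    · intro j M'' _ hA' h26 hcell
      have hr' : M'' 2 k = r k := by rw [hA' 2 (by decide), hA 2 (by decide), hr k hk]
      have h17' : M'' 17 0 = k := by rw [hA' 17 (by decide), h17]
      have hE'' := hE'.agree hA' (by decide)
      constructor
      · simp [h17', h26, hE''.cols]
      · simp only [eval_mod, eval_mul, eval_div, eval_cell, eval_add, eval_zero, eval_one, h17',
          h26, hE''.cols, hE''.modulus, hr', hcell]
        rfl
    · rintro M'' - ⟨hA', h₁, h₂⟩
      refine ⟨by rw [hA' 17 (by decide), h17],
        (hA.trans (hA'.mono (by decide))).write (by decide) _ _, fun i j hj => ?_⟩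
      have : entry d (M''.write 17 0 (k + 1 : ℕ)) i j = entry d M'' i j := by
        simp [entry, write_apply]
      rw [this]
      by_cases hik : i = k
      · subst hik
        have h₃ := h i j hj
        rw [if_neg (lt_irrefl _)] at h₃
        rw [if_pos (Nat.lt_succ_self _), ← h₃]
        exact h₁ j hj
      · have h₃ : entry d M'' i j = entry d M' i j :=
          h₂ _ fun j' hj' h => hik (address_inj hj hj' h).1
        rw [h₃, h i j hj]
        simp only [show i < k + 1 ↔ i < k by omega]

/-- Prepare the matrix: the scaled rows of `A`, zero rows, and the identity matrix. -/
def setup : Prog :=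
  .seq (.assign 4 0 (.cell 2 (.cell 0 0 - 1))) (.seq (.assign 5 0 (.cell 0 0 + .cell 0 1))
  (.seq scaleRows
    (fill 1 (.cell 0 1) ((var 5 + var 26) * .cell 0 1 + var 26) (1 % var 4))))

theorem runs_setup (hb : Bdd β M) (h0 : M 0 0 = m) (h1 : M 0 1 = d) (hm : 0 < m)
    (hβ : Sizes β m d N) {r : ℕ → ℕ} (hr : ∀ i, i < m → M 2 i = r i) (hrN : r (m - 1) = N) :
    Runs β setup M ((3 * d + 4) * m + 3 * d + 6) fun M' => Env m d N M' ∧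
      ∀ i j, j < d → entry d M' i j =
        if i < m then (entry d M i j * ((N : ℤ) / r i)) % N
        else if i = m + d + j then 1 % (N : ℤ) else entry d M i j := by
  have hdim := hβ.height_le
  refine (Runs.assign_seq (n := (((3 * d + 4) * m + 2) + (3 * d + 2)) + 1) 0 N hb
    ⟨by decide, by decide⟩ rfl ?_ (by simpa using hβ.modulus_le) fun hb₁ => ?_).mono
    (by omega) fun _ _ h => h
  · have := hr (m - 1) (by omega)
    rw [hrN, Nat.cast_sub (show 1 ≤ m from hm)] at this
    simpa [h0] using this
  refine Runs.assign_seq 0 (m + d : ℕ) hb₁ ⟨by decide, by decide⟩ rfl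
    (by simp [write_apply, h0, h1]) (by omega) fun hb₂ => ?_
  have hE : Env m d N ((M.write 4 0 N).write 5 0 (m + d : ℕ)) :=
    ⟨by simp [write_apply, h0], by simp [write_apply, h1], by simp [write_apply],
      by simp⟩
  refine Runs.seq (runs_scaleRows hb₂ hE hβ (r := r) fun i hi => by
    simp [write_apply, hr i hi]) ?_
  rintro M₁ hb₃ ⟨hA, h⟩
  have hE₁ := hE.agree hA (by decide)
  refine (runs_fill (iv := fun j => ((m + d + j : ℕ) : ℤ) * d + j) (ev := fun _ => 1 % (N : ℤ))
    (by decide) hb₃ ⟨by decide, by decide, by decide⟩ (by omega : d ≤ β)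
    (fun j k hj hk h => (address_inj hj hk h).2)
    (fun M'' hA' => by simp [hA' 0 (by decide), hE₁.cols]) ?_
    fun j _ => natAbs_emod_le hβ.pos hβ.modulus_le _).mono le_rfl ?_
  · intro j M' _ hA' h26 _
    have hE' := hE₁.agree hA' (by decide)
    exact ⟨by simp [h26, hE'.cols, hE'.height], by simp [hE'.modulus]⟩
  · rintro M₂ - ⟨hA', h₁, h₂⟩
    refine ⟨hE₁.agree hA' (by decide), fun i j hj => ?_⟩
    have he : ∀ i j, entry d ((M.write 4 0 N).write 5 0 (m + d : ℕ)) i j = entry d M i j :=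
      fun i j => by simp [entry, write_apply]
    simp only [he] at h
    by_cases hij : i = m + d + j
    · subst hij
      rw [if_neg (by omega), if_pos rfl]
      exact h₁ j hj
    · have : entry d M₂ i j = entry d M₁ i j := h₂ _ fun k hk h => by
        obtain ⟨h₃, h₄⟩ := address_inj hj hk h
        omega
      rw [this, h i j hj]
      simp only [if_neg hij]

/-- Euclid's algorithm on the variables `22` and `23`. -/
def euclid : Prog :=
  .loop (var 22)
    (.seq (.assign 24 0 (var 23 % var 22)) (.seq (.assign 23 0 (var 22)) (.assign 22 0 (var 24))))

/-- One division at least halves the product of two numbers `x < y`, so its binary length is a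
variant. -/
theorem runs_euclid (hb : Bdd β M) {x y : ℕ} (hx : M 22 0 = x) (hy : M 23 0 = y) (hxy : x < y)
    (hyN : y ≤ N) (hNβ : N ≤ β) :
    Runs β euclid M (8 * N.size + 1) fun M' =>
      Agree [22, 23, 24] M M' ∧ M' 23 0 = (Nat.gcd x y : ℕ) := by
  refine (Runs.loop (n := 3) (fun M' => Agree [22, 23, 24] M M' ∧ ∃ x' y' : ℕ, M' 22 0 = x' ∧
      M' 23 0 = y' ∧ x' < y' ∧ y' ≤ N ∧ Nat.gcd x' y' = Nat.gcd x y)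
    (fun M' => ((M' 22 0).toNat * (M' 23 0).toNat).size) hb (by decide)
    ⟨Agree.refl _ _, x, y, hx, hy, hxy, hyN, rfl⟩ ?_).mono ?_ ?_
  · rintro M₁ hb₁ ⟨hA, x', y', h22, h23, hlt, hle, hg⟩ hpos
    have hx0 : 0 < x' := by simpa [h22] using hpos
    have hmod := Nat.mod_lt y' hx0
    refine Runs.assign_seq 0 (y' % x' : ℕ) hb₁ ⟨by decide, by decide⟩ rfl
      (by simp [h22, h23]) (by omega) fun hb₂ => ?_
    refine Runs.assign_seq 0 x' hb₂ ⟨by decide, by decide⟩ rfl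
      (by simp [write_apply, h22]) (by omega) fun hb₃ => ?_
    refine Runs.assign (ev := (y' % x' : ℕ)) (iv := 0) hb₃ ⟨by decide, by decide⟩ rfl
      (by simp [write_apply]) (by omega) fun _ => ?_
    refine ⟨⟨((hA.write (by decide) _ _).write (by decide) _ _).write (by decide) _ _,
      y' % x', x', by simp, by simp [write_apply], hmod, by omega, ?_⟩, ?_⟩
    · rw [← Nat.gcd_rec, hg]
    · simp only [write_same, write_of_ne _ _ _ (show (23 : ℕ) ≠ 22 by decide), h22, h23,
        Int.toNat_natCast]
      rcases Nat.eq_zero_or_pos (y' % x') with h | h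
      · rw [h, Nat.zero_mul, Nat.size_zero, Nat.size_pos]
        exact Nat.mul_pos hx0 (by omega)
      · refine size_lt_size (Nat.mul_pos h hx0) ?_
        have h₁ := Nat.div_add_mod y' x'
        have h₂ : 1 ≤ y' / x' := Nat.div_pos hlt.le hx0
        have h₃ : x' * 1 ≤ x' * (y' / x') := Nat.mul_le_mul_left _ h₂
        calc 2 * (y' % x' * x') = 2 * (y' % x') * x' := by ring
          _ ≤ y' * x' := Nat.mul_le_mul_right _ (by omega)
          _ = x' * y' := Nat.mul_comm _ _
  · have h₁ := size_mul_le x y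
    have h₂ := Nat.size_le_size (show x ≤ N by omega)
    have h₃ := Nat.size_le_size hyN
    rw [hx, hy, Int.toNat_natCast, Int.toNat_natCast]
    omega
  · rintro M' - ⟨⟨hA, x', y', h22, h23, -, -, hg⟩, hpos⟩
    refine ⟨hA, ?_⟩
    have : x' = 0 := by simpa [h22] using hpos
    rw [h23, ← hg, this, Nat.gcd_zero_left]

/-- Write the generators which belong to the diagonal matrix into array `3`. -/
def output : Prog :=
  .forUpTo 6 0 (.cell 0 1)
    (.seq (.assign 22 0 (.cell 1 (var 6 * .cell 0 1 + var 6))) (.seq (.assign 23 0 (var 4))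
    (.seq euclid (.seq (.assign 25 0 (var 4 / var 23))
    (fill 3 (.cell 0 1) (var 6 * .cell 0 1 + var 26)
      ((var 25 * .cell 1 ((var 5 + var 26) * .cell 0 1 + var 6)) % var 4))))))

theorem runs_output (hb : Bdd β M) (hE : Env m d N M) (hβ : Sizes β m d N)
    (hI : Inv N (m + d) d K (entry d M)) :
    Runs β output M ((8 * N.size + 3 * d + 8) * d + 2) fun M' => ∀ i j : Fin d,
      M' 3 ((i : ℤ) * d + j) = ((generator N (m + d) (entry d M) i j).val : ℤ) := by
  have hdim := hβ.height_le
  have hN := hβ.pos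
  have hNβ := hβ.modulus_le
  have : NeZero N := ⟨hN.ne'⟩
  refine (Runs.forUpTo (n := 8 * N.size + 3 * d + 6) 0 d
    (fun k M' => Agree [3, 6, 22, 23, 24, 25, 26] M M' ∧
      ∀ i j : Fin d, (i : ℕ) < k →
        M' 3 ((i : ℤ) * d + j) = ((generator N (m + d) (entry d M) i j).val : ℤ))
    hb ⟨by decide, by decide⟩ rfl (Nat.zero_le _) (by omega) ?_ ?_ ?_).mono le_rfl
    fun M' _ h i j => h.2.2 i j i.2
  · exact ⟨(Agree.refl _ _).write (by decide) _ _, fun i j h => absurd h (Nat.not_lt_zero _)⟩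
  · exact fun k M' h => (hE.agree h.1 (by decide)).cols
  · rintro k M₁ hb₁ - hk h6 ⟨hA, h⟩
    have hE₁ := hE.agree hA (by decide)
    have w₁ : M₁ 1 = M 1 := hA 1 (by decide)
    have hk0 := hI.nonneg k k (by omega) hk
    have hkN := hI.lt k k (by omega) hk
    obtain ⟨x, hx⟩ := Int.eq_ofNat_of_zero_le hk0
    refine (Runs.assign_seq (n := ((8 * N.size + 1) + ((3 * d + 2) + 1)) + 1) 0 x hb₁
      ⟨by decide, by decide⟩ rfl ?_ (by omega) fun hb₂ => ?_).mono (by omega) fun _ _ h => h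
    · simp only [eval_cell, eval_add, eval_mul, eval_zero, eval_one, h6, hE₁.cols, w₁]
      exact hx
    refine Runs.assign_seq 0 N hb₂ ⟨by decide, by decide⟩ rfl
      (by simp [write_apply, hE₁.modulus]) (by omega) fun hb₃ => ?_
    refine Runs.seq (runs_euclid (x := x) (y := N) (N := N) hb₃ (by simp [write_apply])
      (by simp) (by omega) le_rfl hNβ) ?_
    rintro M₂ hb₄ ⟨hA₂, h23⟩
    have A₂ : Agree [3, 6, 22, 23, 24, 25, 26] M₁ M₂ :=
      (((Agree.refl _ M₁).write (by decide) _ _).write (by decide) _ _).trans (hA₂.mono (by decide))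
    have hE₂ := hE₁.agree A₂ (by decide)
    have h3₂ : M₂ 3 = M₁ 3 := by
      rw [hA₂ 3 (by decide), write_of_ne _ _ _ (by decide), write_of_ne _ _ _ (by decide)]
    have h6₂ : M₂ 6 0 = k := by
      rw [hA₂ 6 (by decide), write_of_ne _ _ _ (by decide), write_of_ne _ _ _ (by decide), h6]
    set g : ℤ := (N : ℤ) / (Int.gcd (entry d M k k) N : ℤ) with hg
    have hg' : (N : ℤ) / (Nat.gcd x N : ℕ) = g := by rw [hg, hx]; rfl
    have hgN : g.natAbs ≤ N := by
      have := Int.natAbs_ediv_le_natAbs (N : ℤ) (Int.gcd (entry d M k k) N : ℤ)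
      simpa using this
    refine Runs.assign_seq 0 g hb₄ ⟨by decide, by decide⟩ rfl
      (by simpa [h23, hE₂.modulus] using hg') (by omega) fun hb₅ => ?_
    have A₃ : Agree [3, 6, 22, 23, 24, 25, 26] M (M₂.write 25 0 g) :=
      (hA.trans A₂).write (by decide) _ _
    have hE₃ := hE.agree A₃ (by decide)
    refine (runs_fill (iv := fun j => (k : ℤ) * d + j)
      (ev := fun j => (g * entry d M (m + d + j) k) % N) (by decide) hb₅
      ⟨by decide, by decide, by decide⟩ (by omega : d ≤ β) (fun j j' _ _ h => by simpa using h)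
      (fun M'' hA' => by simp [hA' 0 (by decide), hE₃.cols]) ?_
      fun j _ => natAbs_emod_le hN hNβ _).mono le_rfl ?_
    · intro j M' _ hA' h26 _
      have hE' := hE₃.agree hA' (by decide)
      have h6' : M' 6 0 = k := by
        rw [hA' 6 (by decide), write_of_ne _ _ _ (by decide), h6₂]
      have h25' : M' 25 0 = g := by rw [hA' 25 (by decide), write_same]
      have w' : M' 1 = M 1 := by rw [hA' 1 (by decide), A₃ 1 (by decide)]
      exact ⟨by simp [h6', h26, hE'.cols],
        by simp [h6', h26, hE'.cols, hE'.height, hE'.modulus, h25', w', entry]⟩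
    · rintro M' - ⟨hA', h₁, h₂⟩
      refine ⟨?_, (A₃.trans (hA'.mono (by decide))).write (by decide) _ _, fun i j hi => ?_⟩
      · rw [hA' 6 (by decide), write_of_ne _ _ _ (by decide), h6₂]
      rw [write_of_ne _ _ _ (by decide)]
      by_cases hik : (i : ℕ) = k
      · subst hik
        rw [generator, ZMod.val_intCast]
        exact h₁ j j.2
      · rw [h₂ _ fun j' hj' h => hik (address_inj j.2 hj' h).1, write_of_ne _ _ _ (by decide), h3₂]
        exact h i j (by omega)

end NullGen

/-! ### The algorithm on the data of a group relaxation -/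

namespace GroupRelaxation

open RAM Diagonalization NullGen

variable (G : GroupRelaxation)

theorem rLast_pos : 0 < G.rLast := G.r_pos _

/-- Multiplying the congruence modulo `r i` by `r_m / r i` turns it into one modulo `r_m`. -/
theorem mem_K_iff (y : G.Z) : y ∈ G.K ↔ ∀ i,
    ∑ j, ((G.A i j * ((G.rLast : ℤ) / G.r i) : ℤ) : ZMod G.rLast) * y j = 0 := by
  choose k hk using fun j => ZMod.intCast_surjective (y j)
  obtain rfl : (fun j => (k j : ZMod G.rLast)) = y := funext hk
  rw [K, AddMonoidHom.mem_ker, funext_iff]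
  refine forall_congr' fun i => ?_
  obtain ⟨q, hq⟩ := G.r_dvd_rLast i
  have hr := G.r_pos i
  have hq0 : (q : ℤ) ≠ 0 := by
    rintro h
    have := G.rLast_pos
    rw [hq, Int.natCast_eq_zero.1 h] at this
    omega
  have hdiv : (G.rLast : ℤ) / G.r i = q := by
    rw [hq, Nat.cast_mul, Int.mul_ediv_cancel_left _ (by omega)]
  have h₁ : G.hom (fun j => (k j : ZMod G.rLast)) i =
      ((∑ j, G.A i j * k j : ℤ) : ZMod (G.r i)) := by
    simp [hom, ZMod.cast_intCast (G.r_dvd_rLast i)]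
  have h₂ : ∑ j, ((G.A i j * ((G.rLast : ℤ) / G.r i) : ℤ) : ZMod G.rLast) * (k j : ZMod G.rLast) =
      (((∑ j, G.A i j * k j) * q : ℤ) : ZMod G.rLast) := by
    rw [hdiv, Finset.sum_mul]
    push_cast
    exact Finset.sum_congr rfl fun j _ => by ring
  rw [h₁, h₂, Pi.zero_apply, ZMod.intCast_zmod_eq_zero_iff_dvd, ZMod.intCast_zmod_eq_zero_iff_dvd,
    hq, Nat.cast_mul]
  exact (Int.mul_dvd_mul_iff_right hq0).symm

/-- The matrix `A` with natural numbers as indices, extended by zeros. -/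
def extA (i j : ℕ) : ℤ := if h : i < G.m ∧ j < G.d then G.A ⟨i, h.1⟩ ⟨j, h.2⟩ else 0

/-- The numbers `r i` with natural numbers as indices, extended by zeros. -/
def extR (i : ℕ) : ℕ := if h : i < G.m then G.r ⟨i, h⟩ else 0

theorem entry_input (i j : ℕ) (hj : j < G.d) : entry G.d G.input i j = G.extA i j := by
  simp only [entry, input, one_ne_zero, if_true, if_false, extA]
  have hz : ∀ (i' : Fin G.m) (j' : Fin G.d), (i : ℤ) * G.d + j = (i' : ℤ) * G.d + j' ↔
      i = i' ∧ j = j' := fun i' j' =>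
    ⟨fun h => address_inj hj j'.2 h, fun h => by rw [h.1, h.2]⟩
  simp only [hz]
  split_ifs with h
  · rw [Fintype.sum_eq_single ⟨i, h.1⟩, Fintype.sum_eq_single ⟨j, h.2⟩]
    · simp
    · exact fun j' hj' => if_neg fun h' => hj' (Fin.ext h'.2.symm)
    · exact fun i' hi' => Finset.sum_eq_zero fun j' _ =>
        if_neg fun h' => hi' (Fin.ext h'.1.symm)
  · exact Finset.sum_eq_zero fun i' _ => Finset.sum_eq_zero fun j' _ =>
      if_neg fun h' : i = (i' : ℕ) ∧ j = (j' : ℕ) => h ⟨h'.1 ▸ i'.2, hj⟩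

theorem input_two (i : ℕ) (hi : i < G.m) : G.input 2 i = G.extR i := by
  simp only [input, extR, dif_pos hi, OfNat.ofNat_ne_zero, OfNat.ofNat_ne_one, if_true, if_false]
  rw [Fintype.sum_eq_single ⟨i, hi⟩]
  · simp
  · exact fun i' hi' => if_neg fun h => hi' (Fin.ext (by exact_mod_cast h.symm))

/-- A bound for the contents of the memory. -/
def memoryBound : ℕ := G.normA + G.rLast + (G.m + G.d + G.d + 1) * (G.d + 1)

theorem sizes : Sizes G.memoryBound G.m G.d G.rLast :=
  ⟨G.rLast_pos, by unfold memoryBound; omega, by unfold memoryBound; omega⟩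

theorem bdd_input : Bdd G.memoryBound G.input := by
  have hβ := G.sizes.height_le
  intro a z
  unfold input
  split_ifs
  · simp only [Int.natAbs_natCast]; omega
  · simp only [Int.natAbs_natCast]; omega
  · simp
  · by_cases h : ∃ (i : Fin G.m) (j : Fin G.d), z = (i : ℤ) * G.d + j
    · obtain ⟨i, j, rfl⟩ := h
      have h₁ := G.entry_input i j j.2
      have h₂ : (G.A i j).natAbs ≤ G.normA :=
        Finset.le_sup (f := fun ij : Fin G.m × Fin G.d => (G.A ij.1 ij.2).natAbs)
          (Finset.mem_univ (i, j))
      simp only [entry, input, one_ne_zero, if_true, if_false, extA, i.2, j.2, and_self,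
        dite_true, Fin.eta] at h₁
      rw [h₁]
      unfold memoryBound
      omega
    · push Not at h
      refine (congrArg Int.natAbs (Finset.sum_eq_zero fun i _ =>
        Finset.sum_eq_zero fun j _ => if_neg (h i j))).le.trans (by simp)
  · by_cases h : ∃ i : Fin G.m, z = (i : ℤ)
    · obtain ⟨i, rfl⟩ := h
      have h₁ := G.input_two i i.2
      simp only [input, extR, i.2, dite_true, Fin.eta, OfNat.ofNat_ne_zero, OfNat.ofNat_ne_one,
        if_true, if_false] at h₁
      rw [h₁, Int.natAbs_natCast]
      exact (Nat.le_of_dvd G.rLast_pos (G.r_dvd_rLast i)).trans G.sizes.modulus_le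
    · push Not at h
      refine (congrArg Int.natAbs (Finset.sum_eq_zero fun i _ => if_neg (h i))).le.trans (by simp)
  · simp

/-- The matrix prepared by `setup` satisfies the invariant: initially `V` is the identity. -/
theorem inv_setup {W : ℕ → ℕ → ℤ} (hW : ∀ i j, j < G.d → W i j =
      if i < G.m then (G.extA i j * ((G.rLast : ℤ) / G.extR i)) % G.rLast
      else if i = G.m + G.d + j then 1 % (G.rLast : ℤ) else G.extA i j) :
    Inv G.rLast (G.m + G.d) G.d G.K W := by
  have hN : (0 : ℤ) < G.rLast := by exact_mod_cast G.rLast_pos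
  have hext : ∀ i j, ¬ i < G.m → G.extA i j = 0 := fun i j hi =>
    dif_neg fun h => hi h.1
  have hid : ∀ (y : G.Z) (i : Fin G.d), form G.rLast W (G.m + G.d + i) y = y i := by
    intro y i
    rw [form, Fintype.sum_eq_single i]
    · rw [hW _ _ i.2, if_neg (by omega), if_pos rfl]
      push_cast [ZMod.intCast_mod]
      simp
    · intro l hl
      rw [hW _ _ l.2, if_neg (by omega), if_neg fun h => hl (Fin.ext (by omega)),
        hext _ _ (by omega)]
      simp
  refine ⟨fun i j _ hj => ?_, fun i j _ hj => ?_, fun x => ⟨x, hid x⟩, fun y => ?_⟩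
  · rw [hW i j hj]
    split_ifs with h₁
    exacts [Int.emod_nonneg _ hN.ne', Int.emod_nonneg _ hN.ne', (hext i j h₁).ge]
  · rw [hW i j hj]
    split_ifs with h₁
    exacts [Int.emod_lt_of_pos _ hN, Int.emod_lt_of_pos _ hN, by rwa [hext i j h₁]]
  · have h₁ : (fun i : Fin G.d => form G.rLast W (G.m + G.d + i) y) = y := funext (hid y)
    have h₂ : ∀ i : Fin G.m, form G.rLast W i y =
        ∑ j, ((G.A i j * ((G.rLast : ℤ) / G.r i) : ℤ) : ZMod G.rLast) * y j := by
      intro i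
      refine Finset.sum_congr rfl fun j _ => ?_
      rw [hW _ _ j.2, if_pos i.2, ZMod.intCast_mod]
      simp [extA, extR]
    rw [h₁, mem_K_iff]
    constructor
    · exact fun h i => (h₂ i).symm.trans (h i (by omega))
    · intro h i hi
      by_cases him : i < G.m
      · exact (h₂ ⟨i, him⟩).trans (h ⟨i, him⟩)
      · refine Finset.sum_eq_zero fun l _ => ?_
        rw [hW _ _ l.2, if_neg him, if_neg (by omega), hext _ _ him]
        simp

/-- The algorithm: prepare the matrix, diagonalise it modulo `r_m`, read off the generators. -/
def nullGenFinding : Prog := .seq setup (.seq diagonalize output)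

/-- The number of elementary statements executed by `nullGenFinding`. -/
def steps : ℕ :=
  ((3 * G.d + 4) * G.m + 3 * G.d + 6) +
    ((((14 * (G.m + G.d + G.d) + 40 + 1) *
      ((G.m + G.d + G.d + 1) * (G.rLast.size + 1) + 1) + 4) * G.d + 2) +
    ((8 * G.rLast.size + 3 * G.d + 8) * G.d + 2))

theorem runs_nullGenFinding : Runs G.memoryBound nullGenFinding G.input G.steps fun M =>
    ∃ W, Inv G.rLast (G.m + G.d) G.d G.K W ∧ Diag (G.m + G.d) G.d G.d W ∧
      G.IsOutput M (generator G.rLast (G.m + G.d) W) := by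
  refine Runs.seq (runs_setup G.bdd_input (by simp [input]) (by simp [input]) G.m_pos G.sizes
    G.input_two ?_) ?_
  · have : G.m - 1 < G.m := Nat.sub_lt G.m_pos one_pos
    simp only [extR, dif_pos this]
    rfl
  rintro M₁ hb₁ ⟨hE, h⟩
  have hI : Inv G.rLast (G.m + G.d) G.d G.K (entry G.d M₁) := G.inv_setup fun i j hj => by
    rw [h i j hj, G.entry_input i j hj]
  refine Runs.seq (runs_diagonalize hb₁ hE G.sizes hI) ?_
  rintro M₂ hb₂ ⟨hA, hI₂, hD⟩
  exact (runs_output hb₂ (hE.agree hA (by decide)) G.sizes hI₂).mono le_rfl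
    fun M₃ _ h₃ => ⟨_, hI₂, hD, h₃⟩

theorem size_le_log_add_one (x : ℕ) : x.size ≤ Nat.log 2 x + 1 :=
  Nat.size_le.2 (Nat.lt_pow_succ_log_self one_lt_two x)

/-- The total cost is polynomial: there are `O(S ^ 4)` statements of cost `O(S ^ 2)` each. -/
theorem steps_mul_unit_le : G.steps * unit G.memoryBound ≤
    600 * 627200 * (Nat.log 2 G.normA + G.d + G.m + Nat.log 2 G.rLast + 1) ^ 6 := by
  have hA := size_le_log_add_one G.normA
  have hr := size_le_log_add_one G.rLast
  have hβ : G.memoryBound.size + 1 ≤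
      7 * (Nat.log 2 G.normA + G.d + G.m + Nat.log 2 G.rLast + 1) := by
    have h₁ := size_add_le (G.normA + G.rLast) ((G.m + G.d + G.d + 1) * (G.d + 1))
    have h₂ := size_add_le G.normA G.rLast
    have h₃ := size_mul_le (G.m + G.d + G.d + 1) (G.d + 1)
    have h₄ := size_le_self (G.m + G.d + G.d + 1)
    have h₅ := size_le_self (G.d + 1)
    unfold memoryBound
    omega
  -- Every quantity in the bounds is at most a multiple of `S`.
  set S := Nat.log 2 G.normA + G.d + G.m + Nat.log 2 G.rLast + 1 with hS
  have hunit : unit G.memoryBound ≤ 627200 * S ^ 2 := by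
    unfold unit
    calc _ ≤ 8 * (40 * (7 * S)) ^ 2 := by gcongr
      _ = _ := by ring
  have hsteps : G.steps ≤ 600 * S ^ 4 := by
    have hd : G.d ≤ S := by omega
    have hm : G.m ≤ S := by omega
    have hs : G.rLast.size ≤ S := by omega
    have h1 : 1 ≤ S := by omega
    have h2 : S ≤ S ^ 2 := Nat.le_self_pow (by norm_num) S
    have h3 : S ^ 2 ≤ S ^ 4 := Nat.pow_le_pow_right h1 (by norm_num)
    have h4 : S ≤ S ^ 4 := h2.trans h3
    unfold steps
    calc _ ≤ ((3 * S + 4 * S) * S + 3 * S + 6 * S) +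
          ((((14 * (S + S + S) + 40 * S + S) * ((S + S) * (S + S) + S ^ 2) + 4 * S ^ 3) * S + 2 * S) +
          ((8 * S + 3 * S + 8 * S) * S + 2 * S)) := by
          have h5 : G.m + G.d + G.d + 1 ≤ S + S := by omega
          have h6 : 1 ≤ S ^ 2 := Nat.one_le_pow _ _ h1
          have h7 : 1 ≤ S ^ 3 := Nat.one_le_pow _ _ h1
          gcongr <;> omega
      _ = 415 * S ^ 4 + 4 * S ^ 4 + 26 * S ^ 2 + 13 * S := by ring
      _ ≤ _ := by omega
  calc _ ≤ 600 * S ^ 4 * (627200 * S ^ 2) := Nat.mul_le_mul hsteps hunit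
    _ = _ := by ring

end GroupRelaxation

theorem lemma3p3 :
    ∃ (P : RAM.Prog) (p : MvPolynomial (Fin 4) ℕ), ∀ G : GroupRelaxation,
      ∃ (M : RAM.Memory) (t : ℕ) (h : Fin G.d → G.Z),
        RAM.Exec P G.input M t ∧
        t ≤ MvPolynomial.eval ![Nat.log 2 G.normA, G.d, G.m, Nat.log 2 G.rLast] p ∧
        G.IsOutput M h ∧
        AddSubgroup.closure (Set.range h) = G.K ∧
        iSupIndep (fun i => AddSubgroup.zmultiples (h i)) ∧
        Nonempty (G.K ≃+ ⨁ i : Fin G.d, ZMod (Nat.card (AddSubgroup.zmultiples (h i)))) := by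
  open MvPolynomial in
  refine ⟨GroupRelaxation.nullGenFinding, C (600 * 627200) * (X 0 + X 1 + X 2 + X 3 + 1) ^ 6,
    fun G => ?_⟩
  obtain ⟨M, t, hexec, ht, -, W, hI, hD, hout⟩ := G.runs_nullGenFinding
  have hK := Diagonalization.closure_generator G.rLast_pos (Nat.le_add_left _ _) hI hD
  have hind := Diagonalization.generator_independent G.rLast_pos hI
  refine ⟨M, t, _, hexec, ht.trans (G.steps_mul_unit_le.trans (le_of_eq ?_)), hout, hK, hind,
    Diagonalization.nonempty_addEquiv_directSum _ _ hK hind⟩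
  simp
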